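/- Let $n>1$ and let $r(u,v)$ be a function with values in $\operatorname{Mat}_n(\mathbb C)\otimes\operatorname{Mat}_n(\mathbb C)$, meromorphic in a neighborhood of $(0,0)\in\mathbb C^2$. Let $\mathrm P=\sum_{i,j}e_{ij}\otimes e_{ji}$, where $(e_{ij})$ are the matrix units, let $(a\otimes b)^t=a^t\otimes b^t$, let $r^{21}$ be the image of $r$ under $a\otimes b\mapsto b\otimes a$, and let $r^{12}$, $r^{13}$, $r^{23}$ denote the images of $r$ in $\operatorname{Mat}_n(\mathbb C)^{\otimes 3}$ under $a\otimes b\mapsto a\otimes b\otimes 1$, $a\otimes 1\otimes b$, $1\otimes a\otimes b$, respectively. Assume that, as identities of meromorphic functions near the origin, $r$ satisfies the associative Yang--Baxter equation $$r^{12}(-u',v)\,r^{13}(u+u',v+v')-r^{23}(u+u',v')\,r^{12}(u,v)+r^{13}(u,v+v')\,r^{23}(u',v')=0$$ and the skew-symmetry condition $r^{21}(-u,-v)=-r(u,v)$. Assume also that $r$ is strongly nondegenerate: for generic $(u,v)$ near $(0,0)$ both tensors $r(u,v)$ and $r(u,v)^t\cdot\mathrm P$ are nondegenerate, where a tensor in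 $V\otimes V$, $V=\operatorname{Mat}_n(\mathbb C)$, is nondegenerate if the linear map $V^*\to V$ it induces is bijective. Then there are nonzero constants $c,c'\in\mathbb C$ such that $r$ has a simple pole along $u=0$ with polar term $c\cdot\frac{1\otimes 1}{u}$ and a simple pole along $v=0$ with polar term $c'\cdot\frac{\mathrm P}{v}$; that is, $r-c\,\frac{1\otimes 1}{u}$ is regular along $u=0$ and $r-c'\,\frac{\mathrm P}{v}$ is regular along $v=0$. Here a meromorphic function is regular along a line $\ell=0$ through the origin if near the origin it is a quotient $a/g$ of analytic functions with $g$ not identically zero on that line. -/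

import Mathlib

open Filter Topology Matrix

/-- `p` holds at a generic point near `x`: near `x`, it holds off the zero set of an analytic
function that is not identically zero near `x`. -/
def GenericNear {E : Type*} [NormedAddCommGroup E] [NormedSpace ℂ E]
    (x : E) (p : E → Prop) : Prop :=
  ∃ h : E → ℂ, AnalyticAt ℂ h x ∧ ¬ (∀ᶠ z in 𝓝 x, h z = 0) ∧ ∀ᶠ z in 𝓝 x, h z ≠ 0 → p z

/-- An element of `Mat_n(ℂ) ⊗ Mat_n(ℂ)`, written through the Kronecker product as a matrix on
`ℂⁿ ⊗ ℂⁿ`: the entry at `(i, k), (j, l)` is the coefficient of `e_{ij} ⊗ e_{kl}`. The product of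
`Mat_n(ℂ) ⊗ Mat_n(ℂ)` is the matrix product, and `1 ⊗ 1` is the identity matrix. -/
abbrev MatTensor (n : ℕ) : Type := Matrix (Fin n × Fin n) (Fin n × Fin n) ℂ

/-- An element of `Mat_n(ℂ) ⊗ Mat_n(ℂ) ⊗ Mat_n(ℂ)`, in the same way. -/
abbrev MatTensor3 (n : ℕ) : Type :=
  Matrix (Fin n × Fin n × Fin n) (Fin n × Fin n × Fin n) ℂ

namespace MatTensor

variable {n : ℕ}

/-- `r¹²`, that is, `a ⊗ b ↦ a ⊗ b ⊗ 1`. -/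
def leg12 (r : MatTensor n) : MatTensor3 n :=
  Matrix.of fun i j => if i.2.2 = j.2.2 then r (i.1, i.2.1) (j.1, j.2.1) else 0

/-- `r¹³`, that is, `a ⊗ b ↦ a ⊗ 1 ⊗ b`. -/
def leg13 (r : MatTensor n) : MatTensor3 n :=
  Matrix.of fun i j => if i.2.1 = j.2.1 then r (i.1, i.2.2) (j.1, j.2.2) else 0

/-- `r²³`, that is, `a ⊗ b ↦ 1 ⊗ a ⊗ b`. -/
def leg23 (r : MatTensor n) : MatTensor3 n :=
  Matrix.of fun i j => if i.1 = j.1 then r (i.2.1, i.2.2) (j.2.1, j.2.2) else 0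

/-- `r²¹`, that is, `a ⊗ b ↦ b ⊗ a`. -/
def flip (r : MatTensor n) : MatTensor n := r.submatrix Prod.swap Prod.swap

/-- `P = ∑ e_{ij} ⊗ e_{ji}`, the operator `x ⊗ y ↦ y ⊗ x` on `ℂⁿ ⊗ ℂⁿ`. -/
def perm (n : ℕ) : MatTensor n :=
  Matrix.of fun i j => if i.1 = j.2 ∧ i.2 = j.1 then 1 else 0

/-- The matrix of coefficients of a tensor in `V ⊗ V`, `V = Mat_n(ℂ)`, in the basis `e_{ij}` of
`V`: its entry at `(i, j), (k, l)` is the coefficient of `e_{ij} ⊗ e_{kl}`. -/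
def coeffMatrix (r : MatTensor n) : Matrix (Fin n × Fin n) (Fin n × Fin n) ℂ :=
  Matrix.of fun a b => r (a.1, b.1) (a.2, b.2)

/-- A tensor in `V ⊗ V` is nondegenerate if the map `V* → V` that it induces is bijective. -/
def Nondegenerate (r : MatTensor n) : Prop := IsUnit (coeffMatrix r)

/-- `r(u, v)` is meromorphic in a neighborhood of `(0, 0)`: each coefficient is there a quotient
of two analytic functions. Values on the zero set of a denominator are irrelevant. -/
def IsMeromorphic (r : ℂ × ℂ → MatTensor n) : Prop :=
  ∀ i j, ∃ g a : ℂ × ℂ → ℂ, AnalyticAt ℂ g 0 ∧ AnalyticAt ℂ a 0 ∧ ¬ (∀ᶠ z in 𝓝 0, g z = 0) ∧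
    ∀ᶠ z in 𝓝 0, g z ≠ 0 → r z i j = a z / g z

/-- The associative Yang-Baxter equation, as an identity of meromorphic functions of
`(u, u', v, v')` near the origin. -/
def IsAYBE (r : ℂ × ℂ → MatTensor n) : Prop :=
  GenericNear (0 : ℂ × ℂ × ℂ × ℂ) fun ⟨u, u', v, v'⟩ =>
    leg12 (r (-u', v)) * leg13 (r (u + u', v + v'))
      - leg23 (r (u + u', v')) * leg12 (r (u, v))
      + leg13 (r (u, v + v')) * leg23 (r (u', v')) = 0

/-- `r²¹(-u, -v) = -r(u, v)`, as an identity of meromorphic functions near the origin. -/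
def IsSkewSymmetric (r : ℂ × ℂ → MatTensor n) : Prop :=
  GenericNear (0 : ℂ × ℂ) fun ⟨u, v⟩ => flip (r (-u, -v)) = -r (u, v)

/-- `r(u, v)` and `r(u, v)ᵗ · P` are nondegenerate for generic `(u, v)`; the transposition
`(a ⊗ b)ᵗ = aᵗ ⊗ bᵗ` is the transposition of matrices on `ℂⁿ ⊗ ℂⁿ`. -/
def IsStronglyNondegenerate (r : ℂ × ℂ → MatTensor n) : Prop :=
  GenericNear (0 : ℂ × ℂ) (fun z => Nondegenerate (r z)) ∧
    GenericNear (0 : ℂ × ℂ) (fun z => Nondegenerate ((r z)ᵀ * perm n))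

/-- For a coordinate `ℓ` (`u` or `v`), `r` has a simple pole along `ℓ = 0` with polar term
`T / ℓ`: `T` is not zero, and `r = T / ℓ + a / g` with `a` and `g` analytic near the origin and
`g` not identically zero on the line `ℓ = 0`, so that `r - T / ℓ` is regular along `ℓ = 0`. -/
def HasSimplePoleAlong (r : ℂ × ℂ → MatTensor n) (ℓ : ℂ × ℂ → ℂ) (T : MatTensor n) : Prop :=
  T ≠ 0 ∧ ∃ (a : ℂ × ℂ → MatTensor n) (g : ℂ × ℂ → ℂ),
    (∀ i j, AnalyticAt ℂ (fun z => a z i j) 0) ∧ AnalyticAt ℂ g 0 ∧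
    ¬ (∀ᶠ z in 𝓝 0, ℓ z = 0 → g z = 0) ∧
    GenericNear (0 : ℂ × ℂ) fun z => r z = (ℓ z)⁻¹ • T + (g z)⁻¹ • a z

end MatTensor

/-! Contracting the first leg turns r(u,v) into an operator A(u,v) on Mat_n(ℂ). With the
skew-symmetry, the Yang-Baxter equation becomes A(u,w)(a) A(u',w')(b) = A(u+u',w')(A(u,w-w')(a) b) +
A(u+u',w)(a A(u',w'-w)(b)). Write r = b / (v^K g) with g not identically zero on v = 0 and K
minimal, and let Θ(u) be the operator of b(u,0) / g(u,0). Multiplying by (w-w')^K and letting w tend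
to w' gives (`contract_relation`) 0^K A(u,w)(a) A(u',w)(b) = A(u+u',w)(Θ(u)(a) b + (-1)^K a
Θ(u')(b)).

If K > 0, the left side vanishes and A(u+u',w) is injective, so Θ(u)(a) b = -(-1)^K a Θ(u')(b). For
K even this forces Θ = 0; for K odd it makes Θ(u) multiplication by one scalar c, which is the
operator of c P. The leading coefficients at w = 2w' then give 2^K = 2, hence K = 1
(`eq_one_and_eq_smul_perm`).

The case K = 0 is excluded by `LeadingTerm.ne_zero`. There Θ itself satisfies the limit relation,
and invertibility of A forces Θ to be invertible at the first two multiples of a small u. The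
inverse of Θ(u) is a derivation plus multiplication by a central element, and derivations of
Mat_n(ℂ) are inner, so Θ(u) commutes with left multiplication by some non-scalar z
(`exists_not_scalar_map_mul`). Then A(u,w) intertwines left multiplication by z with another left
multiplication, which nondegeneracy of r^t P forbids (`eq_smul_one_of_contract_mul`).

The pole along u = 0 needs no new argument: r(v,u)^t P satisfies the same hypotheses
(`IsSolution.dual`), and this duality exchanges P with 1 ⊗ 1. -/

/-! ### Division of analytic functions by the second coordinate -/

/-- The Taylor coefficients of `z ↦ (f z - f (z.1, 0)) / z.2`, where `p` are those of `f`. -/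
noncomputable def sndQuotientSeries (p : FormalMultilinearSeries ℂ (ℂ × ℂ) ℂ) :
    FormalMultilinearSeries ℂ (ℂ × ℂ) ℂ := fun n =>
  ∑ j : Fin (n + 1), ((p (n + 1)).curryMid j (0, 1)).compContinuousLinearMap fun i =>
    if i.castSucc < j then ContinuousLinearMap.id ℂ (ℂ × ℂ)
    else (ContinuousLinearMap.inl ℂ ℂ ℂ).comp (ContinuousLinearMap.fst ℂ ℂ ℂ)

theorem norm_sndQuotientSeries_le (p : FormalMultilinearSeries ℂ (ℂ × ℂ) ℂ) (n : ℕ) :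
    ‖sndQuotientSeries p n‖ ≤ (n + 1) * ‖p (n + 1)‖ := by
  have key : ∀ j : Fin (n + 1), ‖((p (n + 1)).curryMid j (0, 1)).compContinuousLinearMap
      (fun i : Fin n => if i.castSucc < j then ContinuousLinearMap.id ℂ (ℂ × ℂ)
        else (ContinuousLinearMap.inl ℂ ℂ ℂ).comp (ContinuousLinearMap.fst ℂ ℂ ℂ))‖
      ≤ ‖p (n + 1)‖ := by
    intro j
    refine (ContinuousMultilinearMap.norm_compContinuousLinearMap_le _ _).trans ?_
    have h1 : ‖(p (n + 1)).curryMid j ((0, 1) : ℂ × ℂ)‖ ≤ ‖p (n + 1)‖ := by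
      refine (ContinuousLinearMap.le_opNorm _ _).trans ?_
      rw [ContinuousMultilinearMap.norm_curryMid]
      simp [Prod.norm_def]
    have h2 : (∏ i : Fin n, ‖(if i.castSucc < j then ContinuousLinearMap.id ℂ (ℂ × ℂ)
        else (ContinuousLinearMap.inl ℂ ℂ ℂ).comp (ContinuousLinearMap.fst ℂ ℂ ℂ))‖) ≤ 1 := by
      refine Finset.prod_le_one (fun i _ => norm_nonneg _) fun i _ => ?_
      split_ifs
      · exact ContinuousLinearMap.norm_id_le
      · refine ContinuousLinearMap.opNorm_le_bound _ zero_le_one fun x => ?_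
        simp [Prod.norm_def]
    calc _ ≤ ‖p (n + 1)‖ * 1 := by gcongr
      _ = _ := mul_one _
  refine (norm_sum_le _ _).trans ?_
  refine (Finset.sum_le_sum fun j _ => key j).trans ?_
  simp

/-- A telescoping sum: z is replaced by (z.1, 0) one slot at a time. The jth difference has z -
(z.1, 0) = z.2 • (0, 1) in slot j, and multilinearity pulls out z.2. -/
theorem sndQuotientSeries_apply (p : FormalMultilinearSeries ℂ (ℂ × ℂ) ℂ) (n : ℕ) (z : ℂ × ℂ) :
    z.2 * sndQuotientSeries p n (fun _ => z) =
      p (n + 1) (fun _ => z) - p (n + 1) (fun _ => (z.1, 0)) := by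
  set t : ℕ → ℂ := fun j => p (n + 1) fun i => if (i : ℕ) < j then z else (z.1, 0) with ht
  have h0 : p (n + 1) (fun _ => ((z.1, 0) : ℂ × ℂ)) = t 0 := by simp [ht]
  have h1 : p (n + 1) (fun _ => z) = t (n + 1) := by
    simp only [ht]; congr 1; funext i; rw [if_pos i.isLt]
  rw [h0, h1, ← Finset.sum_range_sub t, Finset.sum_range fun j => t (j + 1) - t j]
  simp only [sndQuotientSeries, _root_.sum_apply, Finset.mul_sum]
  refine Finset.sum_congr rfl fun j _ => ?_
  set m : Fin n → ℂ × ℂ := fun i => if i.castSucc < j then z else (z.1, 0) with hm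
  have e : ∀ (k : ℕ) (x : ℂ × ℂ), (∀ i : Fin n, ((j.succAbove i : Fin (n + 1)) : ℕ) < k ↔
      i.castSucc < j) → (x = if (j : ℕ) < k then z else (z.1, 0)) →
      t k = (p (n + 1)).curryMid j x m := by
    intro k x hk hx
    rw [ContinuousMultilinearMap.curryMid_apply]
    simp only [ht]
    congr 1
    refine (Fin.insertNth_eq_iff.2 ⟨hx, ?_⟩).symm
    funext i
    simp only [hm, Fin.removeNth, hk]
  have hs : ∀ i : Fin n, i.castSucc < j ∧ ((j.succAbove i : Fin (n + 1)) : ℕ) = i ∨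
      ¬ i.castSucc < j ∧ ((j.succAbove i : Fin (n + 1)) : ℕ) = i + 1 := by
    intro i
    by_cases h : i.castSucc < j
    · left; exact ⟨h, by rw [Fin.succAbove_of_castSucc_lt _ _ h]; rfl⟩
    · right; exact ⟨h, by rw [Fin.succAbove_of_le_castSucc _ _ (not_lt.1 h)]; rfl⟩
  rw [e (j + 1) z _ (by simp), e j (z.1, 0) _ (by simp)]
  · have hz : z - (z.1, 0) = z.2 • ((0, 1) : ℂ × ℂ) := by ext <;> simp
    rw [← _root_.sub_apply, ← map_sub, hz, map_smul, _root_.smul_apply, smul_eq_mul,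
      ContinuousMultilinearMap.compContinuousLinearMap_apply]
    congr 2
    funext i
    simp only [hm]
    split_ifs <;> simp
  · intro i
    have := hs i
    simp only [Fin.lt_def, Fin.val_castSucc] at this ⊢
    omega
  · intro i
    have := hs i
    simp only [Fin.lt_def, Fin.val_castSucc] at this ⊢
    omega

theorem radius_sndQuotientSeries_pos {p : FormalMultilinearSeries ℂ (ℂ × ℂ) ℂ}
    (hp : 0 < p.radius) : 0 < (sndQuotientSeries p).radius := by
  obtain ⟨C, r, hC, hr, h⟩ := p.le_mul_pow_of_radius_pos hp
  -- Halving the radius absorbs the factor n + 1 ≤ 2 ^ n of the norm bound.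
  have hs : 0 < 1 / (2 * r) := by positivity
  refine lt_of_lt_of_le (ENNReal.coe_pos.2 (?_ : 0 < (⟨1 / (2 * r), hs.le⟩ : NNReal)))
    ((sndQuotientSeries p).le_radius_of_bound (C * r) fun n => ?_)
  · exact hs
  · have h1 := norm_sndQuotientSeries_le p n
    have h2 := h (n + 1)
    have h3 : ((n : ℝ) + 1) ≤ 2 ^ n := by
      have := Nat.lt_two_pow_self (n := n)
      exact_mod_cast this
    calc ‖sndQuotientSeries p n‖ * (1 / (2 * r)) ^ n
        ≤ (2 ^ n * (C * r ^ (n + 1))) * (1 / (2 * r)) ^ n := by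
          gcongr
          refine h1.trans ?_
          gcongr
      _ = C * r := by
          rw [div_pow, one_pow, mul_pow, pow_succ]; field_simp

theorem AnalyticAt.exists_eq_add_snd_mul {f : ℂ × ℂ → ℂ} (hf : AnalyticAt ℂ f 0) :
    ∃ h : ℂ × ℂ → ℂ, AnalyticAt ℂ h 0 ∧ ∀ᶠ z in 𝓝 0, f z = f (z.1, 0) + z.2 * h z := by
  obtain ⟨p, r, hp⟩ := hf
  have hq := radius_sndQuotientSeries_pos (hp.r_pos.trans_le hp.r_le)
  have hh := (sndQuotientSeries p).hasFPowerSeriesOnBall hq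
  refine ⟨(sndQuotientSeries p).sum, hh.analyticAt, ?_⟩
  filter_upwards [Metric.eball_mem_nhds (0 : ℂ × ℂ) hp.r_pos,
    Metric.eball_mem_nhds (0 : ℂ × ℂ) hq] with z hz hzq
  have hz' : ((z.1, 0) : ℂ × ℂ) ∈ Metric.eball (0 : ℂ × ℂ) r := by
    rw [Metric.mem_eball, edist_zero_right] at hz ⊢
    refine lt_of_le_of_lt ?_ hz
    rw [enorm_le_iff_norm_le]
    simp [Prod.norm_def]
  have s1 := hp.hasSum hz
  have s2 := hp.hasSum hz'
  have s3 := (hh.hasSum hzq).mul_left z.2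
  simp only [zero_add] at s1 s2 s3
  have s4 := s1.sub s2
  have s5 := (hasSum_nat_add_iff' 1).2 s4
  simp only [Finset.sum_range_one] at s5
  have e0 : (p 0 fun _ => z) - (p 0 fun _ => ((z.1, 0) : ℂ × ℂ)) = 0 := by
    rw [sub_eq_zero]; congr 1; funext i; exact i.elim0
  rw [e0, sub_zero] at s5
  have := s3.unique (by simpa only [sndQuotientSeries_apply] using s5)
  rw [this]; ring

/-! ### Zero sets of analytic functions -/

section GenericPoints

variable {E : Type*} [NormedAddCommGroup E] [NormedSpace ℂ E]

/-- By the identity theorem on a ball, the complement of the zero set is dense near the point. This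
is what lets generic identities extend by continuity. -/
theorem AnalyticAt.eventually_frequently_ne_zero {h : E → ℂ} {x : E} (hh : AnalyticAt ℂ h x)
    (hne : ¬ ∀ᶠ z in 𝓝 x, h z = 0) : ∀ᶠ y in 𝓝 x, ∃ᶠ z in 𝓝 y, h z ≠ 0 := by
  obtain ⟨ε, hε, hball⟩ := Metric.eventually_nhds_iff_ball.1 hh.eventually_analyticAt
  filter_upwards [Metric.ball_mem_nhds x hε] with y hy hfr
  simp only [not_not] at hfr
  let _ : NormedSpace ℝ E := NormedSpace.restrictScalars ℝ ℂ E
  have := AnalyticOnNhd.eqOn_zero_of_preconnected_of_eventuallyEq_zero (𝕜 := ℂ) (f := h)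
    (U := Metric.ball x ε) (fun z hz => hball z hz) (convex_ball x ε).isPreconnected hy hfr
  exact hne (Filter.mem_of_superset (Metric.ball_mem_nhds x hε) fun z hz => this hz)

theorem AnalyticAt.not_eventually_mul_eq_zero {f h : E → ℂ} {x : E} (hf : AnalyticAt ℂ f x)
    (hh : AnalyticAt ℂ h x) (hfne : ¬ ∀ᶠ z in 𝓝 x, f z = 0) (hhne : ¬ ∀ᶠ z in 𝓝 x, h z = 0) :
    ¬ ∀ᶠ z in 𝓝 x, f z * h z = 0 := by
  intro H
  refine hfne ?_
  filter_upwards [hh.eventually_frequently_ne_zero hhne, H.eventually_nhds,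
    hf.eventually_continuousAt] with y hy1 hy2 hy3
  by_contra hy
  refine hy1 ?_
  filter_upwards [hy2, hy3.eventually_ne hy] with z hz1 hz2
  simpa [hz2] using hz1

theorem AnalyticAt.not_eventually_prod_eq_zero {ι : Type*} {s : Finset ι} {f : ι → E → ℂ} {x : E}
    (hf : ∀ i ∈ s, AnalyticAt ℂ (f i) x) (hne : ∀ i ∈ s, ¬ ∀ᶠ z in 𝓝 x, f i z = 0) :
    ¬ ∀ᶠ z in 𝓝 x, ∏ i ∈ s, f i z = 0 := by
  classical
  induction s using Finset.induction_on with
  | empty => simp [NeBot.ne]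
  | insert i s his ih =>
    simp only [Finset.prod_insert his]
    refine AnalyticAt.not_eventually_mul_eq_zero (hf i (by simp))
      (Finset.analyticAt_fun_prod _ fun j hj => hf j (by simp [hj])) (hne i (by simp))
      (ih (fun j hj => hf j (by simp [hj])) fun j hj => hne j (by simp [hj]))

/-- Otherwise the one-variable identity theorem on each line through 0 makes f vanish on a whole
ball. -/
theorem AnalyticAt.exists_not_eventually_smul_eq_zero {f : E → ℂ} (hf : AnalyticAt ℂ f 0)
    (hne : ¬ ∀ᶠ z in 𝓝 0, f z = 0) : ∃ w : E, ¬ ∀ᶠ t in 𝓝 (0 : ℂ), f (t • w) = 0 := by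
  by_contra! H
  obtain ⟨ε, hε, hball⟩ := Metric.eventually_nhds_iff_ball.1 hf.eventually_analyticAt
  refine hne (Filter.mem_of_superset (Metric.ball_mem_nhds 0 hε) fun w hw => ?_)
  have hU : IsPreconnected ((fun t : ℂ => t • w) ⁻¹' Metric.ball (0 : E) ε) := by
    refine Convex.isPreconnected ?_
    let _ : NormedSpace ℝ E := NormedSpace.restrictScalars ℝ ℂ E
    exact (convex_ball (0 : E) ε).is_linear_preimage
      ((IsLinearMap.mk (fun x y => add_smul x y w) fun c x => smul_assoc c x w) :
        IsLinearMap ℝ fun t : ℂ => t • w)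
  have han : AnalyticOnNhd ℂ (fun t : ℂ => f (t • w))
      ((fun t : ℂ => t • w) ⁻¹' Metric.ball (0 : E) ε) := fun t ht =>
    AnalyticAt.fun_comp (g := f) (hball _ ht) (by fun_prop)
  have := AnalyticOnNhd.eqOn_zero_of_preconnected_of_eventuallyEq_zero han hU
    (z₀ := 0) (by simpa using hε) (H w)
  simpa using this (show (1 : ℂ) ∈ _ by simpa using hw)

end GenericPoints

/-! ### Order of vanishing along the line v = 0 -/

/-- Division by v must stop: otherwise f is divisible by every v ^ k, hence vanishes to infinite
order at 0 on every line through 0. -/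
theorem AnalyticAt.exists_eq_snd_pow_mul {f : ℂ × ℂ → ℂ} (hf : AnalyticAt ℂ f 0)
    (hne : ¬ ∀ᶠ z in 𝓝 0, f z = 0) : ∃ (k : ℕ) (g : ℂ × ℂ → ℂ), AnalyticAt ℂ g 0 ∧
      (∀ᶠ z in 𝓝 0, f z = z.2 ^ k * g z) ∧ ¬ ∀ᶠ u in 𝓝 (0 : ℂ), g (u, 0) = 0 := by
  by_contra! H
  have key : ∀ k : ℕ, ∃ g : ℂ × ℂ → ℂ, AnalyticAt ℂ g 0 ∧ ∀ᶠ z in 𝓝 0, f z = z.2 ^ k * g z := by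
    intro k
    induction k with
    | zero => exact ⟨f, hf, by simp⟩
    | succ k ih =>
      obtain ⟨g, hg, hfg⟩ := ih
      obtain ⟨h, hh, hgh⟩ := hg.exists_eq_add_snd_mul
      refine ⟨h, hh, ?_⟩
      have h0 : ∀ᶠ z : ℂ × ℂ in 𝓝 0, g (z.1, 0) = 0 :=
        (continuous_fst.tendsto (0 : ℂ × ℂ)).eventually (H k g hg hfg)
      filter_upwards [hfg, hgh, h0] with z h1 h2 h3
      rw [h1, h2, h3]; ring
  obtain ⟨w, hw⟩ := hf.exists_not_eventually_smul_eq_zero hne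
  have hline : Tendsto (fun t : ℂ => t • w) (𝓝 0) (𝓝 0) := by
    have : Continuous fun t : ℂ => t • w := by fun_prop
    simpa using this.tendsto 0
  have hw0 : (0 : ℂ) • w = 0 := zero_smul _ _
  have han : AnalyticAt ℂ (fun t : ℂ => f (t • w)) 0 :=
    AnalyticAt.fun_comp (g := f) (by rwa [hw0]) (by fun_prop)
  refine hw (analyticOrderAt_eq_top.1 (ENat.eq_top_iff_forall_ge.2 fun k => ?_))
  obtain ⟨g, hg, hfg⟩ := key k
  refine (natCast_le_analyticOrderAt han).2 ⟨fun t => w.2 ^ k * g (t • w), ?_, ?_⟩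
  · exact analyticAt_const.mul (AnalyticAt.fun_comp (g := g) (by rwa [hw0]) (by fun_prop))
  · filter_upwards [hline.eventually hfg] with t ht
    rw [ht]; simp [mul_pow]; ring

theorem Filter.Eventually.prodMk_zero {p : ℂ × ℂ → Prop} (hp : ∀ᶠ z in 𝓝 0, p z) :
    ∀ᶠ u in 𝓝 (0 : ℂ), ∀ᶠ v in 𝓝 (0 : ℂ), p (u, v) :=
  Filter.Eventually.curry_nhds (x := (0 : ℂ)) (y := (0 : ℂ)) hp

theorem AnalyticAt.eventually_restrict_ne_zero {g : ℂ × ℂ → ℂ} (hg : AnalyticAt ℂ g 0)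
    (hne : ¬ ∀ᶠ u in 𝓝 (0 : ℂ), g (u, 0) = 0) : ∀ᶠ u in 𝓝[≠] (0 : ℂ), g (u, 0) ≠ 0 := by
  have han : AnalyticAt ℂ (fun u : ℂ => g (u, 0)) 0 :=
    AnalyticAt.fun_comp (g := g) hg (by fun_prop)
  exact han.eventually_eq_zero_or_eventually_ne_zero.resolve_left hne

/-- Once a power of v is factored out, the remaining factor has isolated zeros on v = 0. Thus a
generic condition in (u, v) becomes one on small v ≠ 0 for each fixed small u ≠ 0. -/
theorem AnalyticAt.eventually_eventually_ne_zero {f : ℂ × ℂ → ℂ} (hf : AnalyticAt ℂ f 0)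
    (hne : ¬ ∀ᶠ z in 𝓝 0, f z = 0) :
    ∀ᶠ u in 𝓝[≠] (0 : ℂ), ∀ᶠ v in 𝓝[≠] (0 : ℂ), f (u, v) ≠ 0 := by
  obtain ⟨k, g, hg, hfg, hgne⟩ := hf.exists_eq_snd_pow_mul hne
  filter_upwards [hg.eventually_restrict_ne_zero hgne, hfg.prodMk_zero.filter_mono nhdsWithin_le_nhds,
    hg.eventually_continuousAt.prodMk_zero.filter_mono nhdsWithin_le_nhds] with u h1 h2 h3
  have h4 : ContinuousAt (fun v : ℂ => g (u, v)) 0 :=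
    ContinuousAt.comp' (g := g) h3.self_of_nhds (by fun_prop)
  filter_upwards [(h4.eventually_ne h1).filter_mono nhdsWithin_le_nhds,
    h2.filter_mono nhdsWithin_le_nhds, self_mem_nhdsWithin] with v h5 h6 h7
  rw [h6]
  exact mul_ne_zero (pow_ne_zero _ h7) h5

/-- A factor v is cancelled as long as the whole numerator vanishes on v = 0. The process stops at
the exact pole order, or at K = 0. -/
theorem exists_reduced_quotient {m : Type*} [Finite m] {a : ℂ × ℂ → Matrix m m ℂ}
    {G : ℂ × ℂ → ℂ} (ha : ∀ i j, AnalyticAt ℂ (fun z => a z i j) 0) (hG : AnalyticAt ℂ G 0)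
    (hne : ¬ ∀ᶠ z in 𝓝 0, G z = 0) :
    ∃ (K : ℕ) (b : ℂ × ℂ → Matrix m m ℂ) (g : ℂ × ℂ → ℂ),
      (∀ i j, AnalyticAt ℂ (fun z => b z i j) 0) ∧ AnalyticAt ℂ g 0 ∧
      (¬ ∀ᶠ u in 𝓝 (0 : ℂ), g (u, 0) = 0) ∧
      (K = 0 ∨ ∃ i j, ¬ ∀ᶠ u in 𝓝 (0 : ℂ), b (u, 0) i j = 0) ∧
      ∀ᶠ z in 𝓝 0, z.2 ≠ 0 → (G z)⁻¹ • a z = (z.2 ^ K * g z)⁻¹ • b z := by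
  obtain ⟨k, g, hg, hGg, hgne⟩ := hG.exists_eq_snd_pow_mul hne
  suffices H : ∃ (K : ℕ) (b : ℂ × ℂ → Matrix m m ℂ),
      (∀ i j, AnalyticAt ℂ (fun z => b z i j) 0) ∧
      (K = 0 ∨ ∃ i j, ¬ ∀ᶠ u in 𝓝 (0 : ℂ), b (u, 0) i j = 0) ∧
      ∀ i j, ∀ᶠ z in 𝓝 0, z.2 ≠ 0 → (z.2 ^ k * g z)⁻¹ * a z i j = (z.2 ^ K * g z)⁻¹ * b z i j by
    obtain ⟨K, b, hb, hK, hab⟩ := H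
    refine ⟨K, b, g, hb, hg, hgne, hK, ?_⟩
    filter_upwards [eventually_all.2 fun i => eventually_all.2 (hab i), hGg] with z h1 h2 hz
    ext i j
    simpa [h2] using h1 i j hz
  clear hGg
  induction k generalizing a with
  | zero => exact ⟨0, a, ha, Or.inl rfl, by simp⟩
  | succ k ih =>
    by_cases hz : ∃ i j, ¬ ∀ᶠ u in 𝓝 (0 : ℂ), a (u, 0) i j = 0
    · exact ⟨k + 1, a, ha, Or.inr hz, by simp⟩
    push Not at hz
    choose h hh hah using fun i j => (ha i j).exists_eq_add_snd_mul
    obtain ⟨K, b, hb, hK, hab⟩ := ih (a := fun z => Matrix.of fun i j => h i j z) hh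
    refine ⟨K, b, hb, hK, fun i j => ?_⟩
    have h0 : ∀ᶠ z : ℂ × ℂ in 𝓝 0, a (z.1, 0) i j = 0 :=
      (continuous_fst.tendsto (0 : ℂ × ℂ)).eventually (hz i j)
    filter_upwards [hab i j, hah i j, h0] with z h1 h2 h3 hz2
    rw [← h1 hz2, h2, h3, Matrix.of_apply, pow_succ, zero_add, mul_inv, mul_inv, mul_inv]
    field_simp

/-! ### Tensors as operators on matrices -/

namespace MatTensor

variable {n : ℕ}

/-- The linear map `V → V`, `V = Mat_n(ℂ)`, `x ↦ tr(a x) b` defined by a tensor `a ⊗ b`. -/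
def contract (r : MatTensor n) : Matrix (Fin n) (Fin n) ℂ →ₗ[ℂ] Matrix (Fin n) (Fin n) ℂ where
  toFun x := Matrix.of fun k l => ∑ i, ∑ j, r (i, k) (j, l) * x j i
  map_add' x y := by
    ext k l
    simp [mul_add, Finset.sum_add_distrib]
  map_smul' c x := by
    ext k l
    simp only [Matrix.of_apply, Matrix.smul_apply, smul_eq_mul, RingHom.id_apply, Finset.mul_sum]
    exact Finset.sum_congr rfl fun i _ => Finset.sum_congr rfl fun j _ => by ring

theorem contract_apply (r : MatTensor n) (x : Matrix (Fin n) (Fin n) ℂ) (k l : Fin n) :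
    contract r x k l = ∑ i, ∑ j, r (i, k) (j, l) * x j i := rfl

theorem contract_smul (c : ℂ) (r : MatTensor n) : contract (c • r) = c • contract r := by
  refine LinearMap.ext fun x => ?_
  ext k l
  simp [contract_apply, Finset.mul_sum, mul_assoc]

theorem contract_neg (r : MatTensor n) : contract (-r) = -contract r := by
  rw [← neg_one_smul ℂ r, contract_smul, neg_one_smul ℂ (contract r)]

theorem contract_single (r : MatTensor n) (i j k l : Fin n) :
    contract r (Matrix.single j i 1) k l = r (i, k) (j, l) := by
  rw [contract_apply, Finset.sum_eq_single i, Finset.sum_eq_single j]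
  · simp
  · intro b _ hb; simp [hb.symm]
  · simp
  · intro b _ hb; exact Finset.sum_eq_zero fun c _ => by simp [hb.symm]
  · simp

theorem contract_injective : Function.Injective (contract (n := n)) := by
  intro r s h
  ext ⟨i, k⟩ ⟨j, l⟩
  rw [← contract_single r, h, contract_single]

theorem contract_perm : contract (perm n) = LinearMap.id := by
  refine LinearMap.ext fun x => ?_
  ext k l
  simp [contract_apply, perm, ite_and]

theorem continuous_contract :
    Continuous fun p : MatTensor n × Matrix (Fin n) (Fin n) ℂ => contract p.1 p.2 := by
  refine continuous_matrix fun k l => ?_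
  simp only [contract_apply]
  fun_prop

theorem contract_apply_eq_vecMul (r : MatTensor n) (x : Matrix (Fin n) (Fin n) ℂ) (k l : Fin n) :
    contract r x k l = Matrix.vecMul (fun p : Fin n × Fin n => x p.2 p.1) (coeffMatrix r) (k, l) := by
  simp [contract_apply, Matrix.vecMul, dotProduct, Fintype.sum_prod_type, coeffMatrix, mul_comm]

theorem Nondegenerate.contract_injective {r : MatTensor n} (h : Nondegenerate r) :
    Function.Injective (contract r) := by
  intro x y hxy
  have : Matrix.vecMul (fun p : Fin n × Fin n => x p.2 p.1) (coeffMatrix r) =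
      Matrix.vecMul (fun p : Fin n × Fin n => y p.2 p.1) (coeffMatrix r) := by
    funext ⟨k, l⟩
    rw [← contract_apply_eq_vecMul, ← contract_apply_eq_vecMul, hxy]
  have := Matrix.vecMul_injective_of_isUnit h this
  ext i j
  exact congrFun this (j, i)

/-- The pairing of the first two legs of a tensor with a pair of matrices. -/
def contract₃ (X : MatTensor3 n) (a b : Matrix (Fin n) (Fin n) ℂ) : Matrix (Fin n) (Fin n) ℂ :=
  Matrix.of fun k l => ∑ i₁, ∑ j₁, ∑ i₂, ∑ j₂, X (i₁, i₂, k) (j₁, j₂, l) * a j₁ i₁ * b j₂ i₂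

theorem contract₃_add (X Y : MatTensor3 n) (a b : Matrix (Fin n) (Fin n) ℂ) :
    contract₃ (X + Y) a b = contract₃ X a b + contract₃ Y a b := by
  ext k l
  simp [contract₃, add_mul, Finset.sum_add_distrib]

theorem contract₃_sub (X Y : MatTensor3 n) (a b : Matrix (Fin n) (Fin n) ℂ) :
    contract₃ (X - Y) a b = contract₃ X a b - contract₃ Y a b := by
  ext k l
  simp [contract₃, sub_mul, Finset.sum_sub_distrib]

/-- Serves the three leg computations below, whose two sides differ only by a permutation of the
five summation indices. -/
theorem sum_reindex_five {ι : Type*} [Fintype ι] {M : Type*} [AddCommMonoid M]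
    (e : ι × ι × ι × ι × ι ≃ ι × ι × ι × ι × ι) {f g : ι → ι → ι → ι → ι → M}
    (h : ∀ y, f y.1 y.2.1 y.2.2.1 y.2.2.2.1 y.2.2.2.2 =
      g (e y).1 (e y).2.1 (e y).2.2.1 (e y).2.2.2.1 (e y).2.2.2.2) :
    ∑ a, ∑ b, ∑ c, ∑ d, ∑ x, f a b c d x = ∑ a, ∑ b, ∑ c, ∑ d, ∑ x, g a b c d x := by
  simpa only [Fintype.sum_prod_type] using Fintype.sum_equiv e
    (fun y => f y.1 y.2.1 y.2.2.1 y.2.2.2.1 y.2.2.2.2)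
    (fun y => g y.1 y.2.1 y.2.2.1 y.2.2.2.1 y.2.2.2.2) h

theorem contract₃_leg12_mul_leg13 (p q : MatTensor n) (a b : Matrix (Fin n) (Fin n) ℂ) :
    contract₃ (leg12 p * leg13 q) a b = contract q (a * contract (flip p) b) := by
  ext k l
  simp only [contract₃, contract_apply, Matrix.of_apply, Matrix.mul_apply, Fintype.sum_prod_type,
    leg12, leg13, flip, Matrix.submatrix_apply, Prod.swap]
  simp [Finset.sum_mul, Finset.mul_sum]
  exact sum_reindex_five ⟨fun y => (y.2.2.2.2, y.2.1, y.1, y.2.2.1, y.2.2.2.1),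
    fun y => (y.2.2.1, y.2.1, y.2.2.2.1, y.2.2.2.2, y.1), fun _ => rfl, fun _ => rfl⟩ fun y => by simp only [Equiv.coe_fn_mk]; ring

theorem contract₃_leg23_mul_leg12 (p q : MatTensor n) (a b : Matrix (Fin n) (Fin n) ℂ) :
    contract₃ (leg23 q * leg12 p) a b = contract q (contract p a * b) := by
  ext k l
  simp only [contract₃, contract_apply, Matrix.of_apply, Matrix.mul_apply, Fintype.sum_prod_type,
    leg12, leg23]
  simp [Finset.sum_mul, Finset.mul_sum]
  exact sum_reindex_five ⟨fun y => (y.2.2.1, y.2.2.2.2, y.2.2.2.1, y.1, y.2.1),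
    fun y => (y.2.2.2.1, y.2.2.2.2, y.1, y.2.2.1, y.2.1), fun _ => rfl, fun _ => rfl⟩ fun y => by simp only [Equiv.coe_fn_mk]; ring

theorem contract₃_leg13_mul_leg23 (p q : MatTensor n) (a b : Matrix (Fin n) (Fin n) ℂ) :
    contract₃ (leg13 p * leg23 q) a b = contract p a * contract q b := by
  ext k l
  simp only [contract₃, contract_apply, Matrix.of_apply, Matrix.mul_apply, Fintype.sum_prod_type,
    leg13, leg23]
  simp [Finset.sum_mul, Finset.mul_sum]
  exact sum_reindex_five ⟨fun y => (y.2.2.2.2, y.2.2.1, y.2.2.2.1, y.1, y.2.1),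
    fun y => (y.2.2.2.1, y.2.2.2.2, y.2.1, y.2.2.1, y.1), fun _ => rfl, fun _ => rfl⟩ fun y => by simp only [Equiv.coe_fn_mk]; ring

theorem contract_mul_contract_of_aybe {p q q' p' s t : MatTensor n}
    (h : leg12 p * leg13 q - leg23 q' * leg12 p' + leg13 s * leg23 t = 0)
    (a b : Matrix (Fin n) (Fin n) ℂ) :
    contract s a * contract t b =
      contract q' (contract p' a * b) - contract q (a * contract (flip p) b) := by
  have h0 : contract₃ (0 : MatTensor3 n) a b = 0 := by ext k l; simp [contract₃]
  rw [← h, contract₃_add, contract₃_sub, contract₃_leg12_mul_leg13, contract₃_leg23_mul_leg12,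
    contract₃_leg13_mul_leg23] at h0
  rw [eq_sub_iff_add_eq, ← sub_eq_zero, ← h0]
  abel

/-- Evaluated at matrix units, the intertwining relation says that the vectors z_{jm} δ_{pk} -
w_{kp} δ_{jm}, indexed by (j, p), are killed by the coefficient matrix of rᵀ P. They therefore
vanish, and p = k gives z = w_{kk} • 1. -/
theorem eq_smul_one_of_contract_mul {r : MatTensor n} (h : Nondegenerate (rᵀ * perm n))
    {z w : Matrix (Fin n) (Fin n) ℂ}
    (hzw : ∀ a, contract r (z * a) = w * contract r a) : ∃ c : ℂ, z = c • 1 := by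
  have hs : ∀ p q : Fin n × Fin n,
      coeffMatrix (rᵀ * perm n) p q = r (q.2, p.2) (p.1, q.1) := by
    intro p q
    simp [coeffMatrix, perm, Matrix.mul_apply, Fintype.sum_prod_type, ite_and]
  have key : ∀ m k : Fin n, (fun p : Fin n × Fin n =>
      z p.1 m * (1 : Matrix (Fin n) (Fin n) ℂ) p.2 k -
        w k p.2 * (1 : Matrix (Fin n) (Fin n) ℂ) p.1 m) = 0 := by
    intro m k
    refine Matrix.vecMul_injective_of_isUnit h ?_
    funext ⟨l, i⟩
    have h1 := congrFun (congrFun (hzw (Matrix.single m i 1)) k) l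
    rw [Matrix.mul_apply, contract_apply, Finset.sum_eq_single i] at h1
    · simp only [contract_single, Matrix.mul_single_apply_same, mul_one] at h1
      simp only [Pi.zero_apply, Matrix.vecMul, dotProduct, hs, sub_mul,
        Finset.sum_sub_distrib, Fintype.sum_prod_type, Matrix.one_apply]
      simp only [mul_ite, mul_one, mul_zero, ite_mul, zero_mul, Finset.sum_ite_eq',
        Finset.mem_univ, if_true, Finset.sum_ite_irrel, Finset.sum_const_zero]
      rw [sub_eq_zero, ← h1]
      exact Finset.sum_congr rfl fun j _ => mul_comm _ _
    · intro i' _ hi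
      exact Finset.sum_eq_zero fun j _ => by
        rw [Matrix.mul_single_apply_of_ne _ _ _ _ _ hi, mul_zero]
    · simp
  rcases isEmpty_or_nonempty (Fin n) with he | ⟨⟨k⟩⟩
  · exact ⟨0, Subsingleton.elim _ _⟩
  refine ⟨w k k, ?_⟩
  ext j m
  have h2 := congrFun (key m k) (j, k)
  simpa [sub_eq_zero] using h2

end MatTensor

/-! ### Derivations and Rota-Baxter families on the matrix algebra -/

namespace MatTensor

variable {n : ℕ}

theorem exists_eq_commutator_of_derivation [NeZero n]
    {D : Matrix (Fin n) (Fin n) ℂ →ₗ[ℂ] Matrix (Fin n) (Fin n) ℂ}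
    (hD : ∀ a b, D (a * b) = a * D b + D a * b) :
    ∃ z : Matrix (Fin n) (Fin n) ℂ, ∀ a, D a = z * a - a * z := by
  -- The witness comes from the separability element ∑ e_{i0} ⊗ e_{0i}, on which left and right
  -- multiplication by a matrix agree.
  refine ⟨∑ i, D (Matrix.single i (0 : Fin n) 1) * Matrix.single (0 : Fin n) i 1, fun a => ?_⟩
  have h1 : ∀ i, a * (D (Matrix.single i (0 : Fin n) 1) * Matrix.single (0 : Fin n) i 1) =
      D (a * Matrix.single i (0 : Fin n) 1) * Matrix.single (0 : Fin n) i 1 - D a * Matrix.single i i 1 := by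
    intro i
    rw [hD, add_mul, mul_assoc (D a), Matrix.single_mul_single_same, mul_one, mul_assoc]
    abel
  have h2 : ∀ i, a * Matrix.single i (0 : Fin n) (1 : ℂ) = ∑ j, a j i • Matrix.single j (0 : Fin n) (1 : ℂ) := by
    intro i
    ext p q
    simp [Matrix.mul_apply, Matrix.sum_apply, Matrix.single_apply, ite_and]
  have h3 : ∀ j, Matrix.single (0 : Fin n) j (1 : ℂ) * a = ∑ i, a j i • Matrix.single (0 : Fin n) i (1 : ℂ) := by
    intro i
    ext p q
    simp [Matrix.mul_apply, Matrix.sum_apply, Matrix.single_apply, ite_and]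
  have h4 : ∑ i, D (a * Matrix.single i (0 : Fin n) 1) * Matrix.single (0 : Fin n) i 1 =
      (∑ i, D (Matrix.single i (0 : Fin n) 1) * Matrix.single (0 : Fin n) i 1) * a := by
    simp only [h2, Finset.sum_mul, mul_assoc, h3, map_sum, map_smul, Finset.mul_sum,
      Matrix.smul_mul, Matrix.mul_smul]
    exact Finset.sum_comm
  rw [← h4, Finset.mul_sum, Finset.sum_congr rfl fun i _ => h1 i, Finset.sum_sub_distrib,
    ← Finset.mul_sum, Matrix.sum_single_one, mul_one]
  abel

theorem exists_not_scalar_derivation_eq_zero (hn : 1 < n)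
    {D : Matrix (Fin n) (Fin n) ℂ →ₗ[ℂ] Matrix (Fin n) (Fin n) ℂ}
    (hD : ∀ a b, D (a * b) = a * D b + D a * b) :
    ∃ z : Matrix (Fin n) (Fin n) ℂ, (¬ ∃ c : ℂ, z = c • 1) ∧ D z = 0 := by
  have : NeZero n := ⟨by omega⟩
  obtain ⟨z, hz⟩ := exists_eq_commutator_of_derivation hD
  by_cases h : ∃ c : ℂ, z = c • 1
  · obtain ⟨c, rfl⟩ := h
    refine ⟨Matrix.single ⟨0, by omega⟩ ⟨1, hn⟩ 1, ?_, by rw [hz]; simp⟩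
    rintro ⟨c, hc⟩
    have := congrFun (congrFun hc ⟨0, by omega⟩) ⟨1, hn⟩
    simp at this
  · exact ⟨z, h, by rw [hz, sub_self]⟩

/-- Simplicity of the matrix algebra: the products x a y span everything. -/
theorem linearMap_eq_zero_of_mul_mul {a : Matrix (Fin n) (Fin n) ℂ} (ha : a ≠ 0)
    {L : Matrix (Fin n) (Fin n) ℂ →ₗ[ℂ] Matrix (Fin n) (Fin n) ℂ}
    (hL : ∀ x y, L (x * (a * y)) = 0) : L = 0 := by
  obtain ⟨k, l, hkl⟩ : ∃ k l, a k l ≠ 0 := by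
    by_contra! H
    exact ha (Matrix.ext H)
  have hs : ∀ i j, L (Matrix.single i j 1) = 0 := by
    intro i j
    have h1 : Matrix.single i k 1 * (a * Matrix.single l j 1) = a k l • Matrix.single i j (1 : ℂ) := by
      rw [← mul_assoc, Matrix.single_mul_mul_single]
      simp
    have h2 := hL (Matrix.single i k 1) (Matrix.single l j 1)
    rw [h1, map_smul] at h2
    exact (smul_eq_zero.1 h2).resolve_left hkl
  refine LinearMap.ext fun x => ?_
  rw [Matrix.matrix_eq_sum_single x, map_sum]
  refine Finset.sum_eq_zero fun i _ => ?_
  rw [map_sum]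
  refine Finset.sum_eq_zero fun j _ => ?_
  have : Matrix.single i j (x i j) = x i j • Matrix.single i j (1 : ℂ) := by simp
  rw [this, map_smul, hs, smul_zero]

/-- A family of bijective maps `C i` that is a Rota-Baxter family relative to `Q`, itself a
Rota-Baxter family: `C 1` intertwines the left multiplications by some non-scalar matrix and some
matrix. -/
theorem exists_not_scalar_map_mul (hn : 1 < n)
    {C Q : ℕ → Matrix (Fin n) (Fin n) ℂ →ₗ[ℂ] Matrix (Fin n) (Fin n) ℂ}
    (hC : ∀ i, 0 < i → i ≤ 6 → Function.Injective (C i))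
    (hCQ : ∀ i j, 0 < i → 0 < j → i + j ≤ 6 → ∀ a b,
      C i a * C j b = C (i + j) (Q i a * b + a * Q j b))
    (hQQ : ∀ i j, 0 < i → 0 < j → i + j ≤ 6 → ∀ a b,
      Q i a * Q j b = Q (i + j) (Q i a * b + a * Q j b)) :
    ∃ z w : Matrix (Fin n) (Fin n) ℂ, (¬ ∃ c : ℂ, z = c • 1) ∧ ∀ a, C 1 (z * a) = w * C 1 a := by
  have : NeZero n := ⟨by omega⟩
  have hinv : ∀ L : Matrix (Fin n) (Fin n) ℂ →ₗ[ℂ] Matrix (Fin n) (Fin n) ℂ,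
      Function.Injective L → ∃ T : Matrix (Fin n) (Fin n) ℂ →ₗ[ℂ] Matrix (Fin n) (Fin n) ℂ,
        (∀ x, L (T x) = x) ∧ ∀ x, T (L x) = x := fun L hL =>
    ⟨(LinearEquiv.ofInjectiveEndo L hL).symm.toLinearMap,
      fun x => (LinearEquiv.ofInjectiveEndo L hL).apply_symm_apply x,
      fun x => (LinearEquiv.ofInjectiveEndo L hL).symm_apply_apply x⟩
  choose! T hT using fun i (h1 : 0 < i) (h2 : i ≤ 6) => hinv (C i) (hC i h1 h2)
  set ψ : ℕ → Matrix (Fin n) (Fin n) ℂ →ₗ[ℂ] Matrix (Fin n) (Fin n) ℂ :=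
    fun i => Q i ∘ₗ T i with hψdef
  have hψC : ∀ i, 0 < i → i ≤ 6 → ∀ x, ψ i (C i x) = Q i x := fun i h1 h2 x => by
    simp [hψdef, (hT i h1 h2).2]
  have hTm : ∀ i j, 0 < i → 0 < j → i + j ≤ 6 → ∀ a b,
      T (i + j) (a * b) = ψ i a * T j b + T i a * ψ j b := by
    intro i j hi hj hij a b
    have h := hCQ i j hi hj hij (T i a) (T j b)
    rw [(hT i hi (by omega)).1, (hT j hj (by omega)).1] at h
    rw [h, (hT (i + j) (by omega) hij).2]
    rfl
  -- Setting ψ i = Q i ∘ (C i)⁻¹ turns the two Rota-Baxter relations into graded multiplicativity.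
  have hψm : ∀ i j, 0 < i → 0 < j → i + j ≤ 6 → ∀ a b, ψ (i + j) (a * b) = ψ i a * ψ j b := by
    intro i j hi hj hij a b
    have h := hQQ i j hi hj hij (T i a) (T j b)
    change Q (i + j) (T (i + j) (a * b)) = Q i (T i a) * Q j (T j b)
    rw [hTm i j hi hj hij, h]
    rfl
  have inj1 : Function.Injective (ψ 1) := by
    rw [injective_iff_map_eq_zero]
    intro a ha
    by_contra hne
    -- A nonzero a killed by `ψ 1` makes `ψ 3` vanish on all products x a y. Then `T 6 1 = 0`,
    -- contradicting invertibility of `C 6`; this is why indices up to 6 are used.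
    have h3 : ψ 3 = 0 := linearMap_eq_zero_of_mul_mul hne fun x y => by
      rw [hψm 1 2 (by omega) (by omega) (by omega), hψm 1 1 (by omega) (by omega) (by omega), ha]
      simp
    have h6 := hTm 3 3 (by omega) (by omega) (by omega) 1 1
    rw [h3] at h6
    have := (hT 6 (by omega) (by omega)).1 1
    simp at h6
    rw [h6, map_zero] at this
    exact zero_ne_one this
  have surj1 : Function.Surjective (ψ 1) := LinearMap.injective_iff_surjective.1 inj1
  have surj2 : Function.Surjective (ψ 2) := by
    obtain ⟨x, hx⟩ := surj1 1
    intro y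
    obtain ⟨a, rfl⟩ := surj1 y
    exact ⟨x * a, by rw [hψm 1 1 (by omega) (by omega) (by omega), hx, one_mul]⟩
  have inj2 : Function.Injective (ψ 2) := LinearMap.injective_iff_surjective.2 surj2
  have injQ : ∀ i, 0 < i → i ≤ 6 → Function.Injective (ψ i) → Function.Injective (Q i) := by
    intro i h1 h2 h x y hxy
    rw [← hψC i h1 h2, ← hψC i h1 h2] at hxy
    exact hC i h1 h2 (h hxy)
  obtain ⟨E₁, hQE₁, hEQ₁⟩ := hinv (Q 1) (injQ 1 (by omega) (by omega) inj1)
  obtain ⟨E₂, hQE₂, hEQ₂⟩ := hinv (Q 2) (injQ 2 (by omega) (by omega) inj2)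
  -- The inverses of a Rota-Baxter family satisfy a Leibniz rule with two different maps. Comparing
  -- the factorisations 1 · a and a · 1 shows that `E₁ 1` is central, and subtracting it leaves a
  -- genuine derivation.
  have hE : ∀ a b, E₂ (a * b) = a * E₁ b + E₁ a * b := by
    intro a b
    have h := hQQ 1 1 (by omega) (by omega) (by omega) (E₁ a) (E₁ b)
    rw [hQE₁, hQE₁] at h
    rw [h, hEQ₂]
  have hd : ∀ a, E₁ 1 * a = a * E₁ 1 := by
    intro a
    have h1 := hE 1 a
    have h2 := hE a 1
    rw [one_mul, one_mul] at h1
    rw [mul_one, mul_one, h1, add_comm] at h2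
    exact add_right_cancel h2
  obtain ⟨z, hz, hDz⟩ := exists_not_scalar_derivation_eq_zero hn
    (D := E₁ - LinearMap.mulLeft ℂ (E₁ 1)) (by
      intro a b
      have h1 := hE 1 (a * b)
      rw [one_mul, one_mul, hE a b] at h1
      simp only [LinearMap.sub_apply, LinearMap.mulLeft_apply, mul_sub, sub_mul]
      rw [← mul_assoc a (E₁ 1) b, ← hd a, mul_assoc (E₁ 1) a b, sub_eq_iff_eq_add]
      rw [← sub_eq_iff_eq_add] at h1
      rw [← h1]
      abel)
  have hE₁z : E₁ z = E₁ 1 * z := by simpa [sub_eq_zero] using hDz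
  have hQz : ∀ a, Q 1 (z * a) = z * Q 1 a := by
    intro a
    have h1 := hE z (Q 1 a)
    have h2 := hE 1 (z * Q 1 a)
    rw [one_mul, one_mul, h1, hEQ₁, hE₁z, mul_assoc] at h2
    rw [add_right_cancel h2, hQE₁]
  -- This w transports z through `ψ 1`; the intertwining is then checked after the injective `ψ 2`.
  obtain ⟨w, hw⟩ := surj1 (ψ 1 1 * z)
  refine ⟨z, w, hz, fun a => inj2 ?_⟩
  have h1 := hψm 1 1 (by omega) (by omega) (by omega) 1 (C 1 (z * a))
  rw [one_mul] at h1
  rw [h1, hψm 1 1 (by omega) (by omega) (by omega), hw, hψC 1 (by omega) (by omega),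
    hψC 1 (by omega) (by omega), hQz, mul_assoc]

end MatTensor

/-! ### The leading term along v = 0 -/

namespace MatTensor

variable {n : ℕ}

theorem exists_eq_smul_one_of_forall_commute {x : Matrix (Fin n) (Fin n) ℂ}
    (hx : ∀ a, a * x = x * a) : ∃ c : ℂ, x = c • 1 := by
  obtain ⟨c, hc⟩ := Matrix.mem_range_scalar_of_commute_single (M := x) fun i j _ => hx _
  exact ⟨c, by rw [← hc, Matrix.smul_one_eq_diagonal]; rfl⟩

theorem tendsto_contract {α : Type*} {l : Filter α} {r : α → MatTensor n}
    {x : α → Matrix (Fin n) (Fin n) ℂ} {r₀ : MatTensor n} {x₀ : Matrix (Fin n) (Fin n) ℂ}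
    (hr : Tendsto r l (𝓝 r₀)) (hx : Tendsto x l (𝓝 x₀)) :
    Tendsto (fun t => contract (r t) (x t)) l (𝓝 (contract r₀ x₀)) := by
  have h := (continuous_contract.tendsto (r₀, x₀)).comp (hr.prodMk_nhds hx)
  exact h

/-- The associative Yang-Baxter equation for a skew-symmetric `q`, in terms of contractions. -/
def ContractedAYBE (q : ℂ × ℂ → MatTensor n) (u u' w w' : ℂ) : Prop :=
  ∀ a b, contract (q (u, w)) a * contract (q (u', w')) b =
    contract (q (u + u', w')) (contract (q (u, w - w')) a * b) +
      contract (q (u + u', w)) (a * contract (q (u', w' - w)) b)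

/-- A solution `q(u, v)` of the associative Yang-Baxter equation whose leading term along `v = 0`
is `Θ u / v ^ K`, for `u ≠ 0` with `‖u‖ < ε`. -/
structure LeadingTerm (q : ℂ × ℂ → MatTensor n) (K : ℕ) (Θ : ℂ → MatTensor n) (ε : ℝ) : Prop where
  pos : 0 < ε
  aybe : ∀ u u' : ℂ, u ≠ 0 → ‖u‖ < ε → u' ≠ 0 → ‖u'‖ < ε → u + u' ≠ 0 → ‖u + u'‖ < ε →
    ∀ᶠ w in 𝓝[≠] (0 : ℂ), ∀ᶠ t in 𝓝[≠] (0 : ℂ), ContractedAYBE q u u' (w + t) w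
  aybe_two : ∀ u u' : ℂ, u ≠ 0 → ‖u‖ < ε → u' ≠ 0 → ‖u'‖ < ε → u + u' ≠ 0 → ‖u + u'‖ < ε →
    ∀ᶠ t in 𝓝[≠] (0 : ℂ), ContractedAYBE q u u' (2 * t) t
  continuousAt : ∀ u : ℂ, u ≠ 0 → ‖u‖ < ε →
    ∀ᶠ w in 𝓝[≠] (0 : ℂ), ContinuousAt (fun v => q (u, v)) w
  nondegenerate : ∀ u : ℂ, u ≠ 0 → ‖u‖ < ε →
    ∀ᶠ w in 𝓝[≠] (0 : ℂ), Nondegenerate (q (u, w))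
  nondegenerate_transpose : ∀ u : ℂ, u ≠ 0 → ‖u‖ < ε →
    ∀ᶠ w in 𝓝[≠] (0 : ℂ), Nondegenerate ((q (u, w))ᵀ * perm n)
  tendsto : ∀ u : ℂ, u ≠ 0 → ‖u‖ < ε →
    Tendsto (fun v => v ^ K • q (u, v)) (𝓝[≠] (0 : ℂ)) (𝓝 (Θ u))

namespace LeadingTerm

variable {q : ℂ × ℂ → MatTensor n} {K : ℕ} {Θ : ℂ → MatTensor n} {ε : ℝ}

theorem tendsto_comp_mul (h : LeadingTerm q K Θ ε) {u : ℂ} (hu : u ≠ 0) (huε : ‖u‖ < ε)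
    {c : ℂ} (hc : c ≠ 0) :
    Tendsto (fun t => (c * t) ^ K • q (u, c * t)) (𝓝[≠] (0 : ℂ)) (𝓝 (Θ u)) := by
  refine (h.tendsto u hu huε).comp (tendsto_nhdsWithin_of_tendsto_nhds_of_eventually_within _ ?_ ?_)
  · have : Continuous fun t : ℂ => c * t := by fun_prop
    simpa using (this.tendsto 0).mono_left nhdsWithin_le_nhds
  · filter_upwards [self_mem_nhdsWithin] with t ht
    exact mul_ne_zero hc ht

/-- The equation at (w + t, w) is multiplied by t ^ K and t tends to 0. The sign comes from the
second singular argument, which is -t. Writing 0 ^ K treats K = 0 and K > 0 together. -/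
theorem contract_relation (h : LeadingTerm q K Θ ε) {u u' : ℂ} (hu : u ≠ 0) (huε : ‖u‖ < ε)
    (hu' : u' ≠ 0) (huε' : ‖u'‖ < ε) (hs : u + u' ≠ 0) (hsε : ‖u + u'‖ < ε) :
    ∀ᶠ w in 𝓝[≠] (0 : ℂ), ∀ a b,
      (0 : ℂ) ^ K • (contract (q (u, w)) a * contract (q (u', w)) b) =
        contract (q (u + u', w)) (contract (Θ u) a * b + (-1 : ℂ) ^ K • (a * contract (Θ u') b)) := by
  filter_upwards [h.aybe u u' hu huε hu' huε' hs hsε, h.continuousAt u hu huε,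
    h.continuousAt _ hs hsε] with w hw hc1 hc2 a b
  have hadd : Tendsto (fun t : ℂ => w + t) (𝓝[≠] 0) (𝓝 w) := by
    have : Continuous fun t : ℂ => w + t := by fun_prop
    simpa using (this.tendsto 0).mono_left nhdsWithin_le_nhds
  have hid : Tendsto (fun t : ℂ => t) (𝓝[≠] 0) (𝓝 0) := tendsto_id.mono_left nhdsWithin_le_nhds
  have l1 : Tendsto (fun t : ℂ => t ^ K • (contract (q (u, w + t)) a * contract (q (u', w)) b))
      (𝓝[≠] 0) (𝓝 ((0 : ℂ) ^ K • (contract (q (u, w)) a * contract (q (u', w)) b))) :=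
    (hid.pow K).smul ((tendsto_contract (hc1.tendsto.comp hadd) tendsto_const_nhds).mul
      tendsto_const_nhds)
  have hneg := h.tendsto_comp_mul hu' huε' (c := -1) (by norm_num)
  have l2 : Tendsto (fun t : ℂ =>
      contract (q (u + u', w)) (contract (t ^ K • q (u, t)) a * b) +
        contract (q (u + u', w + t))
          (a * contract ((-1 : ℂ) ^ K • ((-1 * t) ^ K • q (u', -1 * t))) b)) (𝓝[≠] 0)
      (𝓝 (contract (q (u + u', w)) (contract (Θ u) a * b) +
        contract (q (u + u', w)) (a * contract ((-1 : ℂ) ^ K • Θ u') b))) := by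
    refine Tendsto.add (tendsto_contract tendsto_const_nhds ((tendsto_contract
      (h.tendsto u hu huε) tendsto_const_nhds).mul tendsto_const_nhds)) ?_
    exact tendsto_contract (hc2.tendsto.comp hadd) (tendsto_const_nhds.mul
      (tendsto_contract (hneg.const_smul _) tendsto_const_nhds))
  rw [contract_smul, LinearMap.smul_apply, Matrix.mul_smul, ← map_add] at l2
  refine tendsto_nhds_unique l1 (l2.congr' ?_)
  filter_upwards [hw] with t ht
  have e : (-1 : ℂ) ^ K * (-1 * t) ^ K = t ^ K := by
    rw [← mul_pow]; congr 1; ring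
  rw [ht a b, smul_smul, e]
  simp only [contract_smul, LinearMap.smul_apply, smul_add, Matrix.mul_smul, Matrix.smul_mul,
    map_smul, add_sub_cancel_left, sub_add_cancel_left, neg_mul, one_mul]

theorem ne_zero (h : LeadingTerm q K Θ ε) (hn : 1 < n) : K ≠ 0 := by
  rintro rfl
  have hε := h.pos
  -- With this u all multiples i u, 0 < i ≤ 6, are nonzero and of norm at most ε / 2.
  set u : ℂ := ((ε / 12 : ℝ) : ℂ) with hu
  have hmul : ∀ i : ℕ, 0 < i → i ≤ 6 → (i : ℂ) * u ≠ 0 ∧ ‖(i : ℂ) * u‖ < ε := by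
    intro i h0 h6
    have h1 : ((i : ℝ)) ≤ 6 := by exact_mod_cast h6
    refine ⟨mul_ne_zero (by exact_mod_cast h0.ne') ?_, ?_⟩
    · rw [hu]; exact_mod_cast (by positivity : ε / 12 ≠ 0)
    · rw [norm_mul, hu, Complex.norm_real, Complex.norm_natCast, Real.norm_of_nonneg (by positivity)]
      nlinarith
  have hrel : ∀ i j : ℕ, 0 < i → 0 < j → i + j ≤ 6 → ∀ᶠ w in 𝓝[≠] (0 : ℂ), ∀ a b,
      contract (q (i * u, w)) a * contract (q (j * u, w)) b =
        contract (q ((i + j : ℕ) * u, w))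
          (contract (Θ (i * u)) a * b + a * contract (Θ (j * u)) b) := by
    intro i j hi hj hij
    have h1 := hmul i hi (by omega)
    have h2 := hmul j hj (by omega)
    have h3 := hmul (i + j) (by omega) hij
    have e : ((i + j : ℕ) : ℂ) * u = i * u + j * u := by push_cast; ring
    rw [e] at h3 ⊢
    simpa using h.contract_relation h1.1 h1.2 h2.1 h2.2 h3.1 h3.2
  have hlim : ∀ i : ℕ, 0 < i → i ≤ 6 → ∀ x, Tendsto (fun w => contract (q (i * u, w)) x)
      (𝓝[≠] (0 : ℂ)) (𝓝 (contract (Θ (i * u)) x)) := by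
    intro i h0 h6 x
    have h1 := hmul i h0 h6
    have h2 := h.tendsto _ h1.1 h1.2
    simp only [pow_zero, one_smul] at h2
    exact tendsto_contract h2 tendsto_const_nhds
  -- As K = 0, the operators of q converge to those of Θ, so letting w tend to 0 gives Θ the same
  -- relation.
  have hQQ : ∀ i j : ℕ, 0 < i → 0 < j → i + j ≤ 6 → ∀ a b,
      contract (Θ (i * u)) a * contract (Θ (j * u)) b =
        contract (Θ ((i + j : ℕ) * u))
          (contract (Θ (i * u)) a * b + a * contract (Θ (j * u)) b) := by
    intro i j hi hj hij a b
    refine tendsto_nhds_unique ((hlim i hi (by omega) a).mul (hlim j hj (by omega) b))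
      ((hlim (i + j) (by omega) hij _).congr' ?_)
    filter_upwards [hrel i j hi hj hij] with w hw
    exact (hw a b).symm
  have hall : ∀ᶠ w in 𝓝[≠] (0 : ℂ),
      (∀ i ∈ Finset.range 7, 0 < i → Nondegenerate (q (i * u, w))) ∧
      (∀ i ∈ Finset.range 7, ∀ j ∈ Finset.range 7, 0 < i → 0 < j → i + j ≤ 6 → ∀ a b,
        contract (q (i * u, w)) a * contract (q (j * u, w)) b =
          contract (q ((i + j : ℕ) * u, w))
            (contract (Θ (i * u)) a * b + a * contract (Θ (j * u)) b)) ∧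
      Nondegenerate ((q ((1 : ℕ) * u, w))ᵀ * perm n) := by
    refine Eventually.and ?_ (Eventually.and ?_ ?_)
    · refine (Filter.eventually_all_finset _).2 fun i hi => ?_
      by_cases h0 : 0 < i
      · have h1 := hmul i h0 (by simp at hi; omega)
        filter_upwards [h.nondegenerate _ h1.1 h1.2] with w hw _ using hw
      · exact Eventually.of_forall fun w hi => absurd hi h0
    · refine (Filter.eventually_all_finset _).2 fun i _ => (Filter.eventually_all_finset _).2
        fun j _ => ?_
      by_cases hij : 0 < i ∧ 0 < j ∧ i + j ≤ 6
      · filter_upwards [hrel i j hij.1 hij.2.1 hij.2.2] with w hw _ _ _ using hw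
      · exact Eventually.of_forall fun w h1 h2 h3 => absurd ⟨h1, h2, h3⟩ hij
    · have h1 := hmul 1 (by omega) (by omega)
      exact h.nondegenerate_transpose _ h1.1 h1.2
  obtain ⟨w, h1, h2, h3⟩ := hall.exists
  obtain ⟨z, y, hz, hzy⟩ := exists_not_scalar_map_mul hn (C := fun i => contract (q (i * u, w)))
    (Q := fun i => contract (Θ (i * u)))
    (fun i h0 h6 => (h1 i (by simp; omega) h0).contract_injective)
    (fun i j hi hj hij => h2 i (by simp; omega) j (by simp; omega) hi hj hij) hQQ
  exact hz (eq_smul_one_of_contract_mul h3 hzy)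

theorem eq_one_and_eq_smul_perm (h : LeadingTerm q K Θ ε) (hK : K ≠ 0)
    {u₀ : ℂ} (hu₀ : u₀ ≠ 0) (hu₀ε : ‖u₀‖ < ε / 2) (hΘ : Θ u₀ ≠ 0) :
    K = 1 ∧ ∃ c : ℂ, c ≠ 0 ∧ ∀ᶠ u in 𝓝[≠] (0 : ℂ), Θ u = c • perm n := by
  have hε := h.pos
  have hrel : ∀ u u' : ℂ, u ≠ 0 → ‖u‖ < ε / 2 → u' ≠ 0 → ‖u'‖ < ε / 2 → u + u' ≠ 0 → ∀ a b,
      contract (Θ u) a * b = (-(-1 : ℂ) ^ K) • (a * contract (Θ u') b) := by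
    intro u u' hu huε hu' huε' hs a b
    have hsε : ‖u + u'‖ < ε := (norm_add_le _ _).trans_lt (by linarith)
    obtain ⟨w, h1, h2⟩ := ((h.contract_relation hu (by linarith) hu' (by linarith) hs hsε).and
      (h.nondegenerate _ hs hsε)).exists
    have h3 := h1 a b
    rw [zero_pow hK, zero_smul] at h3
    have h4 := (injective_iff_map_eq_zero _).1 h2.contract_injective _ h3.symm
    rw [neg_smul]
    exact eq_neg_of_add_eq_zero_left h4
  have h2u₀ : u₀ + u₀ ≠ 0 := by rw [← two_mul]; exact mul_ne_zero two_ne_zero hu₀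
  have h₀ := hrel u₀ u₀ hu₀ hu₀ε hu₀ hu₀ε h2u₀
  -- For even K, a = b = 1 gives Θ(1) = -Θ(1), so Θ(1) = 0; then b = 1 gives Θ = 0.
  have hodd : (-1 : ℂ) ^ K = -1 := by
    rcases neg_one_pow_eq_or ℂ K with hK1 | hK1
    · exfalso
      rw [hK1] at h₀
      have h1 := h₀ 1 1
      rw [mul_one, one_mul, neg_smul, one_smul, eq_neg_iff_add_eq_zero, ← two_smul ℂ,
        smul_eq_zero_iff_right two_ne_zero] at h1
      refine hΘ (contract_injective (LinearMap.ext fun a => ?_))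
      have h2 := h₀ a 1
      rw [mul_one, h1, mul_zero, smul_zero] at h2
      rw [h2]
      ext k l
      simp [contract_apply]
    · exact hK1
  rw [hodd] at hrel h₀
  simp only [neg_neg, one_smul] at hrel h₀
  have hΘ1 : ∀ a, contract (Θ u₀) a = a * contract (Θ u₀) 1 := fun a => by
    simpa using h₀ a 1
  obtain ⟨c, hc⟩ := exists_eq_smul_one_of_forall_commute (x := contract (Θ u₀) 1) fun a => by
    rw [← hΘ1]; simpa using (h₀ 1 a).symm
  have hperm : ∀ u, u ≠ 0 → ‖u‖ < ε / 2 → u + u₀ ≠ 0 → Θ u = c • perm n := by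
    intro u hu huε hs
    refine contract_injective (LinearMap.ext fun a => ?_)
    have h1 := hrel u u₀ hu huε hu₀ hu₀ε hs a 1
    rw [mul_one, hc] at h1
    rw [h1, contract_smul, contract_perm]
    simp
  have hc0 : c ≠ 0 := by
    rintro rfl
    exact hΘ (by rw [hperm u₀ hu₀ hu₀ε h2u₀, zero_smul])
  refine ⟨?_, c, hc0, ?_⟩
  -- Both u₁ and u₁ + u₁ = u₀ have the known leading term c P. At (w, w') = (2t, t) with a = b = 1,
  -- multiplying by (2t)^K t^K and passing to the limit gives c² = 2^K c² - c².
  · set u₁ : ℂ := u₀ / 2 with hu₁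
    have hsum : u₁ + u₁ = u₀ := add_halves u₀
    have hu₁0 : u₁ ≠ 0 := div_ne_zero hu₀ two_ne_zero
    have hu₁ε : ‖u₁‖ < ε / 2 := by
      rw [hu₁, norm_div, Complex.norm_two]
      linarith [norm_nonneg u₀]
    have hu₁s : u₁ + u₀ ≠ 0 := by
      rw [hu₁, show u₀ / 2 + u₀ = 3 / 2 * u₀ by ring]
      exact mul_ne_zero (by norm_num) hu₀
    have hΘ₁ := hperm u₁ hu₁0 hu₁ε hu₁s
    have hΘ₀ := hperm u₀ hu₀ hu₀ε h2u₀
    have lim : ∀ u, u ≠ 0 → ‖u‖ < ε / 2 → Θ u = c • perm n → ∀ s : ℂ, s ≠ 0 →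
        Tendsto (fun t => (s * t) ^ K • q (u, s * t)) (𝓝[≠] (0 : ℂ)) (𝓝 (c • perm n)) := by
      intro u h1 h2 h3 s hs
      rw [← h3]
      exact h.tendsto_comp_mul h1 (by linarith) hs
    have l1 := (tendsto_contract (lim u₁ hu₁0 hu₁ε hΘ₁ 2 two_ne_zero)
      (tendsto_const_nhds (x := (1 : Matrix (Fin n) (Fin n) ℂ)))).mul
      (tendsto_contract (lim u₁ hu₁0 hu₁ε hΘ₁ 1 one_ne_zero)
      (tendsto_const_nhds (x := (1 : Matrix (Fin n) (Fin n) ℂ))))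
    have l2 := (tendsto_contract (lim u₀ hu₀ hu₀ε hΘ₀ 1 one_ne_zero)
      ((tendsto_contract (lim u₁ hu₁0 hu₁ε hΘ₁ 1 one_ne_zero)
      (tendsto_const_nhds (x := (1 : Matrix (Fin n) (Fin n) ℂ)))).mul
      (tendsto_const_nhds (x := (1 : Matrix (Fin n) (Fin n) ℂ))))).const_smul ((2 : ℂ) ^ K)
    have l3 := (tendsto_contract (lim u₀ hu₀ hu₀ε hΘ₀ 2 two_ne_zero)
      ((tendsto_const_nhds (x := (1 : Matrix (Fin n) (Fin n) ℂ))).mul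
      (tendsto_contract (lim u₁ hu₁0 hu₁ε hΘ₁ (-1) (by norm_num))
      (tendsto_const_nhds (x := (1 : Matrix (Fin n) (Fin n) ℂ)))))).const_smul ((-1 : ℂ) ^ K)
    have key := tendsto_nhds_unique l1 ((l2.add l3).congr' ?_)
    · simp only [contract_smul, contract_perm, LinearMap.smul_apply, LinearMap.id_apply, mul_one,
        hodd, Matrix.mul_smul, one_mul, smul_smul, ← add_smul] at key
      have hn0 : Nonempty (Fin n) := by
        by_contra hn0
        rw [not_nonempty_iff] at hn0
        exact hΘ (Subsingleton.elim _ _)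
      obtain ⟨i⟩ := hn0
      have h1 := congrFun (congrFun key i) i
      simp only [Matrix.smul_apply, Matrix.one_apply_eq, smul_eq_mul, mul_one] at h1
      have h2 : (2 : ℂ) ^ K = 2 ^ 1 := by
        have h3 : (2 ^ K - 2) * (c * c) = 0 := by linear_combination -h1
        rw [pow_one]
        exact sub_eq_zero.1 ((mul_eq_zero.1 h3).resolve_right (mul_ne_zero hc0 hc0))
      have h4 : (2 : ℕ) ^ K = 2 ^ 1 := by exact_mod_cast h2
      exact Nat.pow_right_injective le_rfl h4
    · have hid := h.aybe_two u₁ u₁ hu₁0 (by linarith) hu₁0 (by linarith) (by rwa [hsum])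
        (by rw [hsum]; linarith)
      filter_upwards [hid] with t ht
      have h1 := ht 1 1
      rw [hsum, show 2 * t - t = t by ring, show t - 2 * t = -t by ring] at h1
      have e1 : (-1 : ℂ) ^ K * (-t) ^ K = t ^ K := by
        rw [← mul_pow]; congr 1; ring
      simp only [contract_smul, LinearMap.smul_apply, Matrix.mul_smul, Matrix.smul_mul, map_smul,
        one_mul, neg_mul, smul_smul, mul_one] at h1 ⊢
      rw [h1, smul_add, mul_pow]
      congr 2
      · ring
      · linear_combination (2 ^ K * t ^ K) * e1
  · have h1 : ∀ᶠ u in 𝓝 (0 : ℂ), u ≠ -u₀ := eventually_ne_nhds (neg_ne_zero.2 hu₀).symm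
    filter_upwards [self_mem_nhdsWithin, h1.filter_mono nhdsWithin_le_nhds,
      mem_nhdsWithin_of_mem_nhds (Metric.ball_mem_nhds (0 : ℂ) (half_pos hε))] with u h2 h3 h4
    exact hperm u h2 (by simpa using h4) fun h5 => h3 (eq_neg_of_add_eq_zero_left h5)

end LeadingTerm

end MatTensor

/-! ### The duality r(u,v) ↦ r(v,u)ᵗ P -/

namespace MatTensor

variable {n : ℕ}

/-- The associative Yang-Baxter equation at a point. -/
def AYBEAt (q : ℂ × ℂ → MatTensor n) (u u' v v' : ℂ) : Prop :=
  leg12 (q (-u', v)) * leg13 (q (u + u', v + v'))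
    - leg23 (q (u + u', v')) * leg12 (q (u, v))
    + leg13 (q (u, v + v')) * leg23 (q (u', v')) = 0

theorem AYBEAt.contractedAYBE {q : ℂ × ℂ → MatTensor n} {u u' w w' : ℂ}
    (h : AYBEAt q u u' (w - w') w') (hskew : flip (q (-u', w - w')) = -q (u', w' - w)) :
    ContractedAYBE q u u' w w' := by
  intro a b
  have h1 := contract_mul_contract_of_aybe h a b
  rw [sub_add_cancel, hskew, contract_neg] at h1
  rw [h1, LinearMap.neg_apply, mul_neg, map_neg, sub_neg_eq_add]

theorem leg12_mul_leg13_apply (p q : MatTensor n) (i j : Fin n × Fin n × Fin n) :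
    (leg12 p * leg13 q) i j =
      ∑ m, p (i.1, i.2.1) (m, j.2.1) * q (m, i.2.2) (j.1, j.2.2) := by
  simp [Matrix.mul_apply, Fintype.sum_prod_type, leg12, leg13]

theorem leg23_mul_leg12_apply (p q : MatTensor n) (i j : Fin n × Fin n × Fin n) :
    (leg23 q * leg12 p) i j =
      ∑ m, q (i.2.1, i.2.2) (m, j.2.2) * p (i.1, m) (j.1, j.2.1) := by
  simp [Matrix.mul_apply, Fintype.sum_prod_type, leg12, leg23]

theorem leg13_mul_leg23_apply (p q : MatTensor n) (i j : Fin n × Fin n × Fin n) :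
    (leg13 p * leg23 q) i j =
      ∑ m, p (i.1, i.2.2) (j.1, m) * q (i.2.1, m) (j.2.1, j.2.2) := by
  simp [Matrix.mul_apply, Fintype.sum_prod_type, leg13, leg23]

theorem transpose_mul_perm_apply (r : MatTensor n) (i j : Fin n × Fin n) :
    (rᵀ * perm n) i j = r (j.2, j.1) i := by
  simp [perm, Matrix.mul_apply, Fintype.sum_prod_type, ite_and]

theorem perm_mul_perm : perm n * perm n = 1 := by
  ext ⟨i, k⟩ ⟨j, l⟩
  simp [perm, Matrix.mul_apply, Fintype.sum_prod_type, ite_and, Matrix.one_apply]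

/-- Entrywise, this is the original equation with row and column indices exchanged and the legs
permuted cyclically. Its three terms are permuted, up to a global sign, and skew-symmetry adjusts
the factor at (-v', -u'). -/
theorem AYBEAt.transpose_mul_perm {q : ℂ × ℂ → MatTensor n} {u u' v v' : ℂ}
    (h : AYBEAt q v v' (-u') (u + u')) (hskew : flip (q (-v', -u')) = -q (v', u')) :
    AYBEAt (fun z => (q z.swap)ᵀ * perm n) u u' v v' := by
  ext ⟨i₁, i₂, i₃⟩ ⟨j₁, j₂, j₃⟩
  have h1 := congrFun (congrFun h (j₂, j₃, j₁)) (i₁, i₂, i₃)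
  have h2 : ∀ x y : Fin n × Fin n, q (-v', -u') x y = -q (v', u') x.swap y.swap := fun x y => by
    have := congrFun (congrFun hskew x.swap) y.swap
    simpa [flip] using this
  have e : -u' + (u + u') = u := by ring
  rw [e] at h1
  simp only [Matrix.add_apply, Matrix.sub_apply, leg12_mul_leg13_apply, leg23_mul_leg12_apply,
    leg13_mul_leg23_apply, h2, Matrix.zero_apply, Prod.swap_prod_mk,
    transpose_mul_perm_apply, neg_mul, Finset.sum_neg_distrib] at h1 ⊢
  simp only [mul_comm] at h1 ⊢
  linear_combination -h1

/-- A strongly nondegenerate skew-symmetric solution `a / G` of the associative Yang-Baxter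
equation near the origin, with an even denominator `G`. -/
structure IsSolution (a : ℂ × ℂ → MatTensor n) (G : ℂ × ℂ → ℂ) : Prop where
  analyticAt_num : ∀ i j, AnalyticAt ℂ (fun z => a z i j) 0
  analyticAt_den : AnalyticAt ℂ G 0
  den_ne_zero : ¬ ∀ᶠ z in 𝓝 0, G z = 0
  den_neg : ∀ z, G (-z) = G z
  aybe : ∀ᶠ y : ℂ × ℂ × ℂ × ℂ in 𝓝 0,
    G (-y.2.1, y.2.2.1) ≠ 0 → G (y.1 + y.2.1, y.2.2.1 + y.2.2.2) ≠ 0 →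
    G (y.1 + y.2.1, y.2.2.2) ≠ 0 → G (y.1, y.2.2.1) ≠ 0 → G (y.1, y.2.2.1 + y.2.2.2) ≠ 0 →
    G (y.2.1, y.2.2.2) ≠ 0 → AYBEAt (fun z => (G z)⁻¹ • a z) y.1 y.2.1 y.2.2.1 y.2.2.2
  skew : ∀ᶠ z in 𝓝 0, G z ≠ 0 → flip ((G (-z))⁻¹ • a (-z)) = -((G z)⁻¹ • a z)
  det_ne_zero : ¬ ∀ᶠ z in 𝓝 0, (coeffMatrix (a z)).det = 0
  det_transpose_ne_zero : ¬ ∀ᶠ z in 𝓝 0, (coeffMatrix ((a z)ᵀ * perm n)).det = 0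

theorem not_eventually_comp_swap {p : ℂ × ℂ → Prop} (h : ¬ ∀ᶠ z in 𝓝 (0 : ℂ × ℂ), p z) :
    ¬ ∀ᶠ z in 𝓝 (0 : ℂ × ℂ), p z.swap := fun H => h <| by
  have hs : Tendsto (Prod.swap : ℂ × ℂ → ℂ × ℂ) (𝓝 0) (𝓝 0) := continuous_swap.tendsto 0
  simpa using hs.eventually H

theorem analyticAt_comp_swap {f : ℂ × ℂ → ℂ} (hf : AnalyticAt ℂ f 0) :
    AnalyticAt ℂ (fun z : ℂ × ℂ => f z.swap) 0 :=
  AnalyticAt.fun_comp (g := f) (f := Prod.swap) (x := (0 : ℂ × ℂ)) hf (analyticAt_snd.prod analyticAt_fst)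

theorem coeffMatrix_transpose_mul_perm (r : MatTensor n) :
    coeffMatrix ((rᵀ * perm n)ᵀ * perm n) = (coeffMatrix r)ᵀ := by
  ext p q
  simp only [coeffMatrix, Matrix.of_apply, transpose_mul_perm_apply, Matrix.transpose_apply]

theorem IsSolution.dual {a : ℂ × ℂ → MatTensor n} {G : ℂ × ℂ → ℂ} (h : IsSolution a G) :
    IsSolution (fun z => (a z.swap)ᵀ * perm n) (fun z => G z.swap) where
  analyticAt_num i j := by
    simp only [transpose_mul_perm_apply]
    exact analyticAt_comp_swap (h.analyticAt_num _ _)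
  analyticAt_den := analyticAt_comp_swap h.analyticAt_den
  den_ne_zero := not_eventually_comp_swap h.den_ne_zero
  den_neg z := h.den_neg z.swap
  aybe := by
    have hL : Tendsto (fun y : ℂ × ℂ × ℂ × ℂ => ((y.2.2.1, y.2.2.2, -y.2.1, y.1 + y.2.1) :
        ℂ × ℂ × ℂ × ℂ)) (𝓝 0) (𝓝 0) := by
      have : Continuous (fun y : ℂ × ℂ × ℂ × ℂ => ((y.2.2.1, y.2.2.2, -y.2.1, y.1 + y.2.1) :
        ℂ × ℂ × ℂ × ℂ)) := by fun_prop
      exact this.tendsto' 0 0 (by simp)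
    have hM : Tendsto (fun y : ℂ × ℂ × ℂ × ℂ => ((y.2.2.2, y.2.1) : ℂ × ℂ)) (𝓝 0) (𝓝 0) := by
      have : Continuous (fun y : ℂ × ℂ × ℂ × ℂ => ((y.2.2.2, y.2.1) : ℂ × ℂ)) := by fun_prop
      exact this.tendsto' 0 0 (by simp)
    filter_upwards [hL.eventually h.aybe, hM.eventually h.skew] with ⟨u, u', v, v'⟩ h1 h2
    simp only [Prod.swap_prod_mk, Prod.neg_mk] at h1 h2 ⊢
    rw [show -u' + (u + u') = u by ring] at h1
    intro g1 g2 g3 g4 g5 g6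
    have g7 : G (-v', -u') ≠ 0 := by
      have := h.den_neg (v', u')
      simp only [Prod.neg_mk] at this
      rwa [this]
    have := (h1 g7 g5 g2 g1 g4 g3).transpose_mul_perm (h2 g6)
    simpa using this
  skew := by
    have hs : Tendsto (Prod.swap : ℂ × ℂ → ℂ × ℂ) (𝓝 0) (𝓝 0) := continuous_swap.tendsto 0
    filter_upwards [hs.eventually h.skew] with z h1 hz
    have h2 := h1 hz
    ext ⟨i, k⟩ ⟨j, l⟩
    have h3 := congrFun (congrFun h2 (l, j)) (i, k)
    simpa [flip, transpose_mul_perm_apply] using h3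
  det_ne_zero := not_eventually_comp_swap h.det_transpose_ne_zero
  det_transpose_ne_zero := by
    simp only [coeffMatrix_transpose_mul_perm, Matrix.det_transpose]
    exact not_eventually_comp_swap h.det_ne_zero

end MatTensor

/-! ### From a solution to its polar term -/

theorem Filter.Eventually.punctured_add {p : ℂ → Prop} (hp : ∀ᶠ v in 𝓝[≠] (0 : ℂ), p v) :
    ∀ᶠ w in 𝓝[≠] (0 : ℂ), ∀ᶠ t in 𝓝[≠] (0 : ℂ), p (w + t) := by
  filter_upwards [eventually_eventually_nhdsWithin.2 hp, self_mem_nhdsWithin] with w hw hw0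
  rw [isOpen_compl_singleton.nhdsWithin_eq hw0] at hw
  have hadd : Tendsto (fun t : ℂ => w + t) (𝓝[≠] 0) (𝓝 w) :=
    ((continuous_const.add continuous_id).tendsto' 0 w (by simp)).mono_left nhdsWithin_le_nhds
  exact hadd.eventually hw

theorem Filter.Eventually.punctured_mul {p : ℂ → Prop} (hp : ∀ᶠ v in 𝓝[≠] (0 : ℂ), p v)
    {c : ℂ} (hc : c ≠ 0) : ∀ᶠ t in 𝓝[≠] (0 : ℂ), p (c * t) := by
  refine Tendsto.eventually
    (tendsto_nhdsWithin_of_tendsto_nhds_of_eventually_within _ ?_ ?_) hp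
  · exact ((continuous_const.mul continuous_id).tendsto' 0 0 (by simp)).mono_left nhdsWithin_le_nhds
  · filter_upwards [self_mem_nhdsWithin] with t ht
    exact mul_ne_zero hc ht

theorem eventually_punctured_norm_lt {ε : ℝ} (hε : 0 < ε) : ∀ᶠ t in 𝓝[≠] (0 : ℂ), ‖t‖ < ε := by
  filter_upwards [mem_nhdsWithin_of_mem_nhds (Metric.ball_mem_nhds (0 : ℂ) hε)] with t ht
  simpa using ht

theorem exists_forall_norm_lt_of_eventually_punctured {p : ℂ → Prop}
    (hp : ∀ᶠ v in 𝓝[≠] (0 : ℂ), p v) : ∃ ε > 0, ∀ u : ℂ, u ≠ 0 → ‖u‖ < ε → p u := by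
  obtain ⟨ε, hε, h⟩ := Metric.mem_nhdsWithin_iff.1 hp
  exact ⟨ε, hε, fun u hu huε => h ⟨by simpa using huε, hu⟩⟩

theorem continuousAt_matrix_of_entries {X m : Type*} [TopologicalSpace X] {f : X → Matrix m m ℂ}
    {x : X} (h : ∀ i j, ContinuousAt (fun y => f y i j) x) : ContinuousAt f x :=
  continuousAt_pi.2 fun i => continuousAt_pi.2 fun j => h i j

theorem eventually_continuousAt_of_analyticAt_entries {E m : Type*} [NormedAddCommGroup E]
    [NormedSpace ℂ E] [Finite m] {f : E → Matrix m m ℂ} {x : E}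
    (h : ∀ i j, AnalyticAt ℂ (fun y => f y i j) x) : ∀ᶠ y in 𝓝 x, ContinuousAt f y := by
  filter_upwards [eventually_all.2 fun i => eventually_all.2 fun j =>
    (h i j).eventually_continuousAt] with y hy
  exact continuousAt_matrix_of_entries hy

namespace MatTensor

variable {n : ℕ}

theorem coeffMatrix_smul (c : ℂ) (r : MatTensor n) : coeffMatrix (c • r) = c • coeffMatrix r := by
  ext p q
  simp [coeffMatrix]

theorem nondegenerate_smul {c : ℂ} (hc : c ≠ 0) {r : MatTensor n}
    (h : (coeffMatrix r).det ≠ 0) : Nondegenerate (c • r) := by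
  rw [Nondegenerate, coeffMatrix_smul, Matrix.isUnit_iff_isUnit_det, Matrix.det_smul]
  exact (mul_ne_zero (pow_ne_zero _ hc) h).isUnit

theorem analyticAt_det_coeffMatrix {f : ℂ × ℂ → MatTensor n}
    (h : ∀ i j, AnalyticAt ℂ (fun z => f z i j) 0) :
    AnalyticAt ℂ (fun z => (coeffMatrix (f z)).det) 0 := by
  simp only [Matrix.det_apply', coeffMatrix, Matrix.of_apply]
  exact Finset.analyticAt_fun_sum _ fun σ _ => analyticAt_const.mul
    (Finset.analyticAt_fun_prod _ fun i _ => h _ _)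

/-- The generic conditions are turned into conditions at each fixed u ≠ 0 of norm less than one
common ε; the finitely many denominators in the equation are then nonzero for small nonzero w and t.
-/
theorem IsSolution.exists_leadingTerm {a : ℂ × ℂ → MatTensor n} {G : ℂ × ℂ → ℂ}
    (h : IsSolution a G) {K : ℕ} {b : ℂ × ℂ → MatTensor n} {g : ℂ × ℂ → ℂ}
    (hb : ∀ i j, AnalyticAt ℂ (fun z => b z i j) 0) (hg : AnalyticAt ℂ g 0)
    (hgne : ¬ ∀ᶠ u in 𝓝 (0 : ℂ), g (u, 0) = 0)
    (hq : ∀ᶠ z in 𝓝 0, z.2 ≠ 0 → (G z)⁻¹ • a z = (z.2 ^ K * g z)⁻¹ • b z) :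
    ∃ ε, LeadingTerm (fun z => (G z)⁻¹ • a z) K (fun u => (g (u, 0))⁻¹ • b (u, 0)) ε := by
  have hE : ∀ᶠ u in 𝓝[≠] (0 : ℂ), (g (u, 0) ≠ 0 ∧
      (∀ᶠ v in 𝓝 (0 : ℂ), v ≠ 0 → (G (u, v))⁻¹ • a (u, v) = (v ^ K * g (u, v))⁻¹ • b (u, v)) ∧
      (∀ᶠ v in 𝓝 (0 : ℂ), ContinuousAt g (u, v)) ∧ (∀ᶠ v in 𝓝 (0 : ℂ), ContinuousAt b (u, v))) ∧
      (∀ᶠ v in 𝓝[≠] (0 : ℂ), G (u, v) ≠ 0) ∧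
      (∀ᶠ v in 𝓝[≠] (0 : ℂ), (coeffMatrix (a (u, v))).det ≠ 0) ∧
      (∀ᶠ v in 𝓝[≠] (0 : ℂ), (coeffMatrix ((a (u, v))ᵀ * perm n)).det ≠ 0) ∧
      (∀ᶠ v in 𝓝 (0 : ℂ), ContinuousAt G (u, v)) ∧ ∀ᶠ v in 𝓝 (0 : ℂ), ContinuousAt a (u, v) := by
    have le := nhdsWithin_le_nhds (a := (0 : ℂ)) (s := {0}ᶜ)
    refine ((hg.eventually_restrict_ne_zero hgne).and <| (hq.prodMk_zero.filter_mono le).and <|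
      (hg.eventually_continuousAt.prodMk_zero.filter_mono le).and
      ((eventually_continuousAt_of_analyticAt_entries hb).prodMk_zero.filter_mono le)).and <|
      (h.analyticAt_den.eventually_eventually_ne_zero h.den_ne_zero).and <|
      ((analyticAt_det_coeffMatrix h.analyticAt_num).eventually_eventually_ne_zero
        h.det_ne_zero).and <|
      ((analyticAt_det_coeffMatrix ?_).eventually_eventually_ne_zero
        h.det_transpose_ne_zero).and <|
      (h.analyticAt_den.eventually_continuousAt.prodMk_zero.filter_mono le).and
      ((eventually_continuousAt_of_analyticAt_entries h.analyticAt_num).prodMk_zero.filter_mono le)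
    intro i j
    simp only [transpose_mul_perm_apply]
    exact h.analyticAt_num _ _
  obtain ⟨ε₁, hε₁, H⟩ := exists_forall_norm_lt_of_eventually_punctured hE
  obtain ⟨ε₂, hε₂, hA⟩ := Metric.eventually_nhds_iff_ball.1 h.aybe
  obtain ⟨ε₃, hε₃, hS⟩ := Metric.eventually_nhds_iff_ball.1 h.skew
  set ε := min ε₁ (min ε₂ ε₃) with hεdef
  have hε : 0 < ε := lt_min hε₁ (lt_min hε₂ hε₃)
  have le1 : ε ≤ ε₁ := min_le_left _ _
  have le2 : ε ≤ ε₂ := (min_le_right _ _).trans (min_le_left _ _)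
  have le3 : ε ≤ ε₃ := (min_le_right _ _).trans (min_le_right _ _)
  have hG : ∀ u : ℂ, u ≠ 0 → ‖u‖ < ε → ∀ᶠ v in 𝓝[≠] (0 : ℂ), G (u, v) ≠ 0 :=
    fun u hu huε => (H u hu (huε.trans_le le1)).2.1
  have key : ∀ u u' w w' : ℂ, ‖u‖ < ε → ‖u'‖ < ε → ‖w'‖ < ε → ‖w - w'‖ < ε →
      G (-u', w - w') ≠ 0 → G (u + u', w) ≠ 0 → G (u + u', w') ≠ 0 → G (u, w - w') ≠ 0 →
      G (u, w) ≠ 0 → G (u', w') ≠ 0 → ContractedAYBE (fun z => (G z)⁻¹ • a z) u u' w w' := by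
    intro u u' w w' hu hu' hw' hw g1 g2 g3 g4 g5 g6
    refine AYBEAt.contractedAYBE ?_ ?_
    · refine hA (u, u', w - w', w') ?_ g1 (by simpa using g2) g3 g4 (by simpa using g5) g6
      rw [mem_ball_zero_iff]
      simp only [Prod.norm_mk, max_lt_iff]
      exact ⟨hu.trans_le le2, hu'.trans_le le2, hw.trans_le le2, hw'.trans_le le2⟩
    · have e : -((u', w' - w) : ℂ × ℂ) = (-u', w - w') := by simp
      have h1 := hS (u', w' - w) (by
        rw [mem_ball_zero_iff]
        simp only [Prod.norm_mk, max_lt_iff]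
        rw [norm_sub_rev]
        exact ⟨hu'.trans_le le3, hw.trans_le le3⟩) (by rwa [← h.den_neg, e])
      rwa [e] at h1
  refine ⟨ε, hε, ?_, ?_, ?_, ?_, ?_, ?_⟩
  · intro u u' hu huε hu' huε' hs hsε
    filter_upwards [eventually_punctured_norm_lt hε, hG _ hs hsε, hG _ hu' huε',
      (hG _ hs hsε).punctured_add, (hG _ hu huε).punctured_add] with w h1 h2 h3 h4 h5
    filter_upwards [eventually_punctured_norm_lt hε, h4, h5, hG _ hu huε,
      hG (-u') (neg_ne_zero.2 hu') (by rwa [norm_neg])] with t h6 h7 h8 h9 h10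
    have e : w + t - w = t := add_sub_cancel_left w t
    exact key u u' (w + t) w huε huε' h1 (by rwa [e]) (by rwa [e]) h7 h2 (by rwa [e]) h8 h3
  · intro u u' hu huε hu' huε' hs hsε
    filter_upwards [eventually_punctured_norm_lt hε, hG _ hs hsε, hG _ hu' huε', hG _ hu huε,
      (hG _ hs hsε).punctured_mul two_ne_zero, (hG _ hu huε).punctured_mul two_ne_zero,
      hG (-u') (neg_ne_zero.2 hu') (by rwa [norm_neg])] with t h1 h2 h3 h4 h5 h6 h7
    have e : 2 * t - t = t := by ring
    exact key u u' (2 * t) t huε huε' h1 (by rwa [e]) (by rwa [e]) h5 h2 (by rwa [e]) h6 h3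
  · intro u hu huε
    obtain ⟨-, h1, -, -, h2, h3⟩ := H u hu (huε.trans_le le1)
    filter_upwards [h1, h2.filter_mono nhdsWithin_le_nhds, h3.filter_mono nhdsWithin_le_nhds]
      with w g1 g2 g3
    have hc : ContinuousAt (fun v : ℂ => ((u, v) : ℂ × ℂ)) w := by fun_prop
    exact ((ContinuousAt.comp' (g := G) g2 hc).inv₀ g1).smul (ContinuousAt.comp' (g := a) g3 hc)
  · intro u hu huε
    obtain ⟨-, h1, h2, -, -, -⟩ := H u hu (huε.trans_le le1)
    filter_upwards [h1, h2] with w g1 g2 using nondegenerate_smul (inv_ne_zero g1) g2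
  · intro u hu huε
    obtain ⟨-, h1, -, h2, -, -⟩ := H u hu (huε.trans_le le1)
    filter_upwards [h1, h2] with w g1 g2
    rw [Matrix.transpose_smul, Matrix.smul_mul]
    exact nondegenerate_smul (inv_ne_zero g1) g2
  · intro u hu huε
    obtain ⟨⟨h1, h2, h3, h4⟩, -⟩ := H u hu (huε.trans_le le1)
    have hc : ContinuousAt (fun v : ℂ => ((u, v) : ℂ × ℂ)) 0 := by fun_prop
    have hl : Tendsto (fun v : ℂ => (g (u, v))⁻¹ • b (u, v)) (𝓝[≠] 0)
        (𝓝 ((g (u, 0))⁻¹ • b (u, 0))) :=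
      (((ContinuousAt.comp' (g := g) h3.self_of_nhds hc).inv₀ h1).smul
        (ContinuousAt.comp' (g := b) h4.self_of_nhds hc)).tendsto.mono_left nhdsWithin_le_nhds
    refine hl.congr' ?_
    filter_upwards [h2.filter_mono nhdsWithin_le_nhds, self_mem_nhdsWithin] with v h5 h6
    have hv : v ^ K ≠ 0 := pow_ne_zero _ h6
    rw [h5 h6, smul_smul, mul_inv, mul_inv_cancel_left₀ hv]

theorem IsSolution.exists_polar_term {a : ℂ × ℂ → MatTensor n} {G : ℂ × ℂ → ℂ}
    (h : IsSolution a G) (hn : 1 < n) :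
    ∃ (c : ℂ) (b : ℂ × ℂ → MatTensor n) (g : ℂ × ℂ → ℂ), c ≠ 0 ∧
      (∀ i j, AnalyticAt ℂ (fun z => b z i j) 0) ∧ AnalyticAt ℂ g 0 ∧
      (¬ ∀ᶠ u in 𝓝 (0 : ℂ), g (u, 0) = 0) ∧
      ∀ᶠ z in 𝓝 0, z.2 ≠ 0 → g z ≠ 0 →
        (G z)⁻¹ • a z = z.2⁻¹ • (c • perm n) + (g z)⁻¹ • b z := by
  obtain ⟨K, b, g, hb, hg, hgne, hK, hq⟩ :=
    exists_reduced_quotient h.analyticAt_num h.analyticAt_den h.den_ne_zero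
  obtain ⟨ε, hL⟩ := h.exists_leadingTerm hb hg hgne hq
  have hK0 := hL.ne_zero hn
  obtain ⟨i, j, hij⟩ := hK.resolve_left hK0
  -- Isolated zeros on v = 0 give a point where neither the chosen numerator entry nor g vanishes,
  -- so the leading term there is nonzero.
  obtain ⟨u₀, h1, h2, h3, h4⟩ := ((hb i j).eventually_restrict_ne_zero hij |>.and <|
    (hg.eventually_restrict_ne_zero hgne).and <|
    (eventually_punctured_norm_lt (half_pos hL.pos)).and self_mem_nhdsWithin).exists
  obtain ⟨rfl, c, hc, hΘ⟩ := hL.eq_one_and_eq_smul_perm hK0 (u₀ := u₀) h4 h3 (by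
    intro h0
    have := congrFun (congrFun h0 i) j
    simp [h1, h2] at this)
  have hd : ∀ i j, AnalyticAt ℂ (fun z => b z i j - g z * (c * perm n i j)) 0 := fun i j =>
    (hb i j).sub (hg.mul analyticAt_const)
  choose f hf hbf using fun i j => (hd i j).exists_eq_add_snd_mul
  refine ⟨c, fun z => Matrix.of fun i j => f i j z, g, hc, hf, hg, hgne, ?_⟩
  -- Since Θ = c P at all small u ≠ 0, the entries of b - g c P vanish on v = 0. They are therefore
  -- divisible by v, and the quotients form the numerator of the regular part.
  have hzero : ∀ i j, ∀ᶠ z : ℂ × ℂ in 𝓝 0,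
      b (z.1, 0) i j - g (z.1, 0) * (c * perm n i j) = 0 := by
    intro i j
    refine (continuous_fst.tendsto (0 : ℂ × ℂ)).eventually
      (p := fun u : ℂ => b (u, 0) i j - g (u, 0) * (c * perm n i j) = 0) ?_
    by_contra hne
    obtain ⟨u, g1, g2, g3⟩ := (((hd i j).eventually_restrict_ne_zero hne).and
      (hΘ.and (hg.eventually_restrict_ne_zero hgne))).exists
    refine g1 ?_
    have g4 := congrFun (congrFun g2 i) j
    simp only [Matrix.smul_apply, smul_eq_mul] at g4
    rw [← g4, mul_inv_cancel_left₀ g3, sub_self]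
  filter_upwards [hq, eventually_all.2 fun i => eventually_all.2 (hbf i),
    eventually_all.2 fun i => eventually_all.2 (hzero i)] with z g1 g2 g3 hz hgz
  rw [g1 hz]
  ext i j
  have g4 := g2 i j
  rw [g3 i j, zero_add, sub_eq_iff_eq_add] at g4
  simp only [Matrix.smul_apply, Matrix.add_apply, smul_eq_mul, Matrix.of_apply, g4, pow_one]
  field_simp
  ring

end MatTensor

/-! ### Common denominators and extension of generic identities -/

namespace MatTensor

variable {n : ℕ}

theorem IsMeromorphic.exists_common_denominator {r : ℂ × ℂ → MatTensor n} (h : IsMeromorphic r) :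
    ∃ (a : ℂ × ℂ → MatTensor n) (G : ℂ × ℂ → ℂ), (∀ i j, AnalyticAt ℂ (fun z => a z i j) 0) ∧
      AnalyticAt ℂ G 0 ∧ (¬ ∀ᶠ z in 𝓝 0, G z = 0) ∧ (∀ z, G (-z) = G z) ∧
      ∀ᶠ z in 𝓝 0, G z ≠ 0 → r z = (G z)⁻¹ • a z := by
  classical
  choose g a hg ha hne hr using h
  -- The factor at -z makes the common denominator even, so that -z avoids its zeros whenever z
  -- does, as skew-symmetry needs.
  set p : (Fin n × Fin n) × (Fin n × Fin n) → ℂ × ℂ → ℂ := fun x z => g x.1 x.2 z * g x.1 x.2 (-z)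
    with hp
  have hneg : Tendsto (fun z : ℂ × ℂ => -z) (𝓝 0) (𝓝 0) := continuous_neg.tendsto' 0 0 neg_zero
  have hgneg : ∀ i j, AnalyticAt ℂ (fun z => g i j (-z)) 0 := fun i j =>
    AnalyticAt.fun_comp (g := g i j) (f := fun z => -z) (x := (0 : ℂ × ℂ)) (by simpa using hg i j)
      analyticAt_id.neg
  have hpa : ∀ x, AnalyticAt ℂ (p x) 0 := fun x => (hg _ _).mul (hgneg _ _)
  have hpne : ∀ x, ¬ ∀ᶠ z in 𝓝 0, p x z = 0 := fun x =>
    (hg _ _).not_eventually_mul_eq_zero (hgneg _ _) (hne _ _) fun H => hne x.1 x.2 <| by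
      simpa using hneg.eventually H
  refine ⟨fun z => Matrix.of fun i j =>
      a i j z * g i j (-z) * ∏ x ∈ Finset.univ.erase (i, j), p x z,
    fun z => ∏ x, p x z, fun i j => ?_, ?_, ?_, fun z => ?_, ?_⟩
  · exact ((ha i j).mul (hgneg i j)).mul (Finset.analyticAt_fun_prod _ fun x _ => hpa x)
  · exact Finset.analyticAt_fun_prod _ fun x _ => hpa x
  · exact AnalyticAt.not_eventually_prod_eq_zero (fun x _ => hpa x) fun x _ => hpne x
  · refine Finset.prod_congr rfl fun x _ => ?_
    simp only [hp, neg_neg, mul_comm]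
  · filter_upwards [eventually_all.2 fun i => eventually_all.2 (hr i)] with z hz hG
    ext i j
    rw [← Finset.mul_prod_erase Finset.univ (fun x => p x z) (Finset.mem_univ (i, j))] at hG
    have h1 := mul_ne_zero_iff.1 hG
    have h2 := mul_ne_zero_iff.1 h1.1
    rw [Matrix.smul_apply, Matrix.of_apply, hz i j h2.1, smul_eq_mul,
      ← Finset.mul_prod_erase Finset.univ (fun x => p x z) (Finset.mem_univ (i, j))]
    have e : p (i, j) z = g i j z * g i j (-z) := rfl
    rw [e]
    have h3 := h1.2
    have h4 := h2.1
    have h5 := h2.2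
    simp only at h4 h5
    field_simp

theorem continuous_leg12 : Continuous (leg12 (n := n)) := by
  refine continuous_matrix fun i j => ?_
  by_cases h : i.2.2 = j.2.2
  · simp only [leg12, Matrix.of_apply, h, if_true]; fun_prop
  · simp only [leg12, Matrix.of_apply, h, if_false]; fun_prop

theorem continuous_leg13 : Continuous (leg13 (n := n)) := by
  refine continuous_matrix fun i j => ?_
  by_cases h : i.2.1 = j.2.1
  · simp only [leg13, Matrix.of_apply, h, if_true]; fun_prop
  · simp only [leg13, Matrix.of_apply, h, if_false]; fun_prop

theorem continuous_leg23 : Continuous (leg23 (n := n)) := by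
  refine continuous_matrix fun i j => ?_
  by_cases h : i.1 = j.1
  · simp only [leg23, Matrix.of_apply, h, if_true]; fun_prop
  · simp only [leg23, Matrix.of_apply, h, if_false]; fun_prop

theorem continuous_flip : Continuous (flip (n := n)) :=
  continuous_id.matrix_submatrix _ _

theorem eq_zero_of_frequently {X Y : Type*} [TopologicalSpace X] [TopologicalSpace Y] [T1Space Y]
    [Zero Y] {f : X → Y} {x : X} (hf : ContinuousAt f x) (h : ∃ᶠ y in 𝓝 x, f y = 0) : f x = 0 := by
  by_contra hne
  exact h (hf.eventually_ne hne)

theorem not_eventually_det_eq_zero {f a : ℂ × ℂ → MatTensor n} {G : ℂ × ℂ → ℂ}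
    (hG : AnalyticAt ℂ G 0) (hGne : ¬ ∀ᶠ z in 𝓝 0, G z = 0)
    (hnd : GenericNear (0 : ℂ × ℂ) fun z => Nondegenerate (f z))
    (hf : ∀ᶠ z in 𝓝 0, G z ≠ 0 → f z = (G z)⁻¹ • a z) :
    ¬ ∀ᶠ z in 𝓝 0, (coeffMatrix (a z)).det = 0 := by
  intro H
  obtain ⟨h, hh, hhne, hN⟩ := hnd
  refine hh.not_eventually_mul_eq_zero hG hhne hGne ?_
  filter_upwards [H, hN, hf] with z h1 h2 h3
  by_contra h4
  obtain ⟨h5, h6⟩ := mul_ne_zero_iff.1 h4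
  have h7 := h2 h5
  rw [h3 h6, Nondegenerate, coeffMatrix_smul, Matrix.isUnit_iff_isUnit_det, Matrix.det_smul, h1, mul_zero] at h7
  exact not_isUnit_zero h7

/-- The identities hold off a nowhere dense zero set near the origin and extend by continuity to
every nearby point where the denominators are nonzero. This matters because the later limits run
along special lines such as w = 2w', which the exceptional set might contain. -/
theorem exists_isSolution {r : ℂ × ℂ → MatTensor n} (hmer : IsMeromorphic r) (haybe : IsAYBE r)
    (hskew : IsSkewSymmetric r) (hnd : IsStronglyNondegenerate r) :
    ∃ (a : ℂ × ℂ → MatTensor n) (G : ℂ × ℂ → ℂ), IsSolution a G ∧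
      ∀ᶠ z in 𝓝 0, G z ≠ 0 → r z = (G z)⁻¹ • a z := by
  obtain ⟨a, G, ha, hG, hGne, hGneg, hr⟩ := hmer.exists_common_denominator
  refine ⟨a, G, ⟨ha, hG, hGne, hGneg, ?_, ?_, ?_, ?_⟩, hr⟩
  · have hloc : ∀ᶠ z in 𝓝 0, G z ≠ 0 → ContinuousAt (fun z => (G z)⁻¹ • a z) z ∧
        ∀ᶠ y in 𝓝 z, r y = (G y)⁻¹ • a y := by
      filter_upwards [hG.eventually_continuousAt, eventually_continuousAt_of_analyticAt_entries ha,
        hr.eventually_nhds] with z h1 h2 h3 hz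
      refine ⟨(h1.inv₀ hz).smul h2, ?_⟩
      filter_upwards [h3, h1.eventually_ne hz] with y h4 h5 using h4 h5
    have hpull : ∀ L : ℂ × ℂ × ℂ × ℂ → ℂ × ℂ, Continuous L → L 0 = 0 → ∀ᶠ y in 𝓝 0,
        G (L y) ≠ 0 → ContinuousAt (fun y => (G (L y))⁻¹ • a (L y)) y ∧
          ∀ᶠ y' in 𝓝 y, r (L y') = (G (L y'))⁻¹ • a (L y') := by
      intro L hL h0
      filter_upwards [(hL.tendsto' 0 0 h0).eventually hloc] with y hy hGy
      exact ⟨ContinuousAt.comp' (g := fun z => (G z)⁻¹ • a z) (hy hGy).1 hL.continuousAt,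
        hL.continuousAt.eventually (hy hGy).2⟩
    obtain ⟨h, hh, hhne, hA⟩ := haybe
    filter_upwards [hh.eventually_frequently_ne_zero hhne, hA.eventually_nhds,
      hpull (fun y => (-y.2.1, y.2.2.1)) (by fun_prop) (by simp),
      hpull (fun y => (y.1 + y.2.1, y.2.2.1 + y.2.2.2)) (by fun_prop) (by simp),
      hpull (fun y => (y.1 + y.2.1, y.2.2.2)) (by fun_prop) (by simp),
      hpull (fun y => (y.1, y.2.2.1)) (by fun_prop) (by simp),
      hpull (fun y => (y.1, y.2.2.1 + y.2.2.2)) (by fun_prop) (by simp),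
      hpull (fun y => (y.2.1, y.2.2.2)) (by fun_prop) (by simp)]
      with y hy1 hy2 l1 l2 l3 l4 l5 l6 g1 g2 g3 g4 g5 g6
    obtain ⟨c1, e1⟩ := l1 g1
    obtain ⟨c2, e2⟩ := l2 g2
    obtain ⟨c3, e3⟩ := l3 g3
    obtain ⟨c4, e4⟩ := l4 g4
    obtain ⟨c5, e5⟩ := l5 g5
    obtain ⟨c6, e6⟩ := l6 g6
    have hcont := (((continuous_leg12.continuousAt.comp' c1).mul
      (continuous_leg13.continuousAt.comp' c2)).sub
      ((continuous_leg23.continuousAt.comp' c3).mul (continuous_leg12.continuousAt.comp' c4))).add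
      ((continuous_leg13.continuousAt.comp' c5).mul (continuous_leg23.continuousAt.comp' c6))
    suffices hfr : ∃ᶠ y' : ℂ × ℂ × ℂ × ℂ in 𝓝 y,
        AYBEAt (fun z => (G z)⁻¹ • a z) y'.1 y'.2.1 y'.2.2.1 y'.2.2.2 from
      (eq_zero_of_frequently hcont hfr :)
    refine (hy1.and_eventually (hy2.and (e1.and (e2.and (e3.and (e4.and (e5.and e6))))))).mono ?_
    rintro ⟨u, u', v, v'⟩ ⟨k0, k, k1, k2, k3, k4, k5, k6⟩
    have := k k0
    simp only [k1, k2, k3, k4, k5, k6] at this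
    exact this
  · obtain ⟨h, hh, hhne, hS⟩ := hskew
    have hneg : Tendsto (fun z : ℂ × ℂ => -z) (𝓝 0) (𝓝 0) := continuous_neg.tendsto' 0 0 neg_zero
    filter_upwards [hh.eventually_frequently_ne_zero hhne, hS.eventually_nhds,
      hG.eventually_continuousAt, eventually_continuousAt_of_analyticAt_entries ha,
      hneg.eventually (eventually_continuousAt_of_analyticAt_entries ha), hr.eventually_nhds,
      (hneg.eventually hr).eventually_nhds] with z h1 h2 h3 h4 h5 h6 h7 hz
    rw [← sub_eq_zero, sub_neg_eq_add]
    have c1 := (h3.inv₀ hz).smul h4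
    have c2 : ContinuousAt (fun z => (G (-z))⁻¹ • a (-z)) z := by
      simp only [hGneg]
      exact (h3.inv₀ hz).smul (ContinuousAt.comp' (g := a) h5 continuous_neg.continuousAt)
    suffices hfr : ∃ᶠ y in 𝓝 z, flip ((G (-y))⁻¹ • a (-y)) + (G y)⁻¹ • a y = 0 from
      (eq_zero_of_frequently ((continuous_flip.continuousAt.comp' c2).add c1) hfr :)
    refine (h1.and_eventually (h2.and (h6.and (h7.and (h3.eventually_ne hz))))).mono ?_
    rintro ⟨u, v⟩ ⟨k0, k1, k2, k3, k4⟩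
    have k5 := k1 k0
    have k6 := k3 (by rwa [hGneg])
    change flip (r (-(u, v))) = - r (u, v) at k5
    rw [k6, k2 k4] at k5
    rw [k5, neg_add_cancel]
  · exact not_eventually_det_eq_zero hG hGne hnd.1 hr
  · refine not_eventually_det_eq_zero hG hGne hnd.2 ?_
    filter_upwards [hr] with z h1 h2
    rw [h1 h2, Matrix.transpose_smul, Matrix.smul_mul]

theorem hasSimplePoleAlong_of_eventually {r a b : ℂ × ℂ → MatTensor n} {G ℓ g : ℂ × ℂ → ℂ}
    {T : MatTensor n} (hT : T ≠ 0) (hG : AnalyticAt ℂ G 0) (hGne : ¬ ∀ᶠ z in 𝓝 0, G z = 0)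
    (hr : ∀ᶠ z in 𝓝 0, G z ≠ 0 → r z = (G z)⁻¹ • a z) (hℓ : AnalyticAt ℂ ℓ 0)
    (hℓne : ¬ ∀ᶠ z in 𝓝 0, ℓ z = 0) (hb : ∀ i j, AnalyticAt ℂ (fun z => b z i j) 0)
    (hg : AnalyticAt ℂ g 0) (hgne : ¬ ∀ᶠ z in 𝓝 0, ℓ z = 0 → g z = 0)
    (h : ∀ᶠ z in 𝓝 0, ℓ z ≠ 0 → g z ≠ 0 → (G z)⁻¹ • a z = (ℓ z)⁻¹ • T + (g z)⁻¹ • b z) :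
    HasSimplePoleAlong r ℓ T := by
  refine ⟨hT, b, g, hb, hg, hgne, fun z => G z * (ℓ z * g z), hG.mul (hℓ.mul hg),
    hG.not_eventually_mul_eq_zero (hℓ.mul hg) hGne
      (hℓ.not_eventually_mul_eq_zero hg hℓne fun H => hgne (H.mono fun z hz _ => hz)), ?_⟩
  filter_upwards [hr, h] with z h1 h2 h3
  obtain ⟨h4, h5⟩ := mul_ne_zero_iff.1 h3
  obtain ⟨h6, h7⟩ := mul_ne_zero_iff.1 h5
  rw [h1 h4, h2 h6 h7]

theorem not_eventually_snd_eq_zero : ¬ ∀ᶠ z : ℂ × ℂ in 𝓝 0, z.2 = 0 := fun H => by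
  have h1 : ∀ᶠ v in 𝓝[≠] (0 : ℂ), v = 0 := by
    have : Tendsto (fun v : ℂ => ((0, v) : ℂ × ℂ)) (𝓝 0) (𝓝 0) :=
      Continuous.tendsto' (by fun_prop) 0 0 rfl
    exact (this.eventually H).filter_mono nhdsWithin_le_nhds
  obtain ⟨v, hv, hv0⟩ := (h1.and self_mem_nhdsWithin).exists
  exact hv0 hv

theorem not_eventually_on_snd_eq_zero {g : ℂ × ℂ → ℂ}
    (hg : ¬ ∀ᶠ u in 𝓝 (0 : ℂ), g (u, 0) = 0) :
    ¬ ∀ᶠ z : ℂ × ℂ in 𝓝 0, z.2 = 0 → g z = 0 := fun H => hg <| by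
  have : Tendsto (fun u : ℂ => ((u, 0) : ℂ × ℂ)) (𝓝 0) (𝓝 0) :=
    Continuous.tendsto' (by fun_prop) 0 0 rfl
  filter_upwards [this.eventually H] with u hu using hu rfl

theorem transpose_transpose_mul_perm_mul_perm (r : MatTensor n) :
    ((rᵀ * perm n) * perm n)ᵀ = r := by
  rw [mul_assoc, perm_mul_perm, mul_one, Matrix.transpose_transpose]

end MatTensor

theorem mainTheorem6 (n : ℕ) (hn : 1 < n) (r : ℂ × ℂ → MatTensor n)
    (hmer : MatTensor.IsMeromorphic r) (haybe : MatTensor.IsAYBE r)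
    (hskew : MatTensor.IsSkewSymmetric r) (hnd : MatTensor.IsStronglyNondegenerate r) :
    ∃ c c' : ℂ, c ≠ 0 ∧ c' ≠ 0 ∧
      MatTensor.HasSimplePoleAlong r Prod.fst (c • (1 : MatTensor n)) ∧
      MatTensor.HasSimplePoleAlong r Prod.snd (c' • MatTensor.perm n) := by
  have i₀ : Fin n := ⟨0, by omega⟩
  have h1 : (1 : MatTensor n) ≠ 0 := fun H => by
    have := congrFun (congrFun H (i₀, i₀)) (i₀, i₀)
    simp at this
  have hP : MatTensor.perm n ≠ 0 := fun H => h1 (by rw [← MatTensor.perm_mul_perm, H, zero_mul])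
  obtain ⟨a, G, hS, hr⟩ := MatTensor.exists_isSolution hmer haybe hskew hnd
  obtain ⟨c', b', g', hc', hb', hg', hg'ne, hpole'⟩ := hS.exists_polar_term hn
  obtain ⟨c, b, g, hc, hb, hg, hgne, hpole⟩ := hS.dual.exists_polar_term hn
  refine ⟨c, c', hc, hc', ?_, ?_⟩
  · refine MatTensor.hasSimplePoleAlong_of_eventually (b := fun z => (b z.swap * MatTensor.perm n)ᵀ)
      (g := fun z => g z.swap) (smul_ne_zero hc h1) hS.analyticAt_den hS.den_ne_zero hr
      analyticAt_fst (MatTensor.not_eventually_comp_swap MatTensor.not_eventually_snd_eq_zero) ?_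
      (MatTensor.analyticAt_comp_swap hg)
      (MatTensor.not_eventually_comp_swap (MatTensor.not_eventually_on_snd_eq_zero hgne)) ?_
    · intro i j
      refine MatTensor.analyticAt_comp_swap (f := fun z => (b z * MatTensor.perm n)ᵀ i j) ?_
      simp only [Matrix.transpose_apply, Matrix.mul_apply]
      exact Finset.analyticAt_fun_sum _ fun k _ => (hb _ _).mul analyticAt_const
    · have hs : Tendsto (Prod.swap : ℂ × ℂ → ℂ × ℂ) (𝓝 0) (𝓝 0) := continuous_swap.tendsto 0
      filter_upwards [hs.eventually hpole] with z hz h1 h2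
      have h3 := hz h1 h2
      simp only [Prod.swap_swap, Prod.snd_swap] at h3
      -- The map M ↦ (M P)ᵀ undoes the duality M ↦ Mᵀ P and sends the polar tensor P to 1 ⊗ 1.
      have h4 := congrArg (fun M => (M * MatTensor.perm n)ᵀ) h3
      simp only [Matrix.smul_mul, Matrix.transpose_smul, MatTensor.transpose_transpose_mul_perm_mul_perm,
        add_mul, Matrix.transpose_add, MatTensor.perm_mul_perm, Matrix.transpose_one] at h4
      exact h4
  · exact MatTensor.hasSimplePoleAlong_of_eventually (smul_ne_zero hc' hP) hS.analyticAt_den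
      hS.den_ne_zero hr analyticAt_snd MatTensor.not_eventually_snd_eq_zero hb' hg'
      (MatTensor.not_eventually_on_snd_eq_zero hg'ne) hpole'
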